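/- **Conventions.** Words are finite words over $\{0,1\}$. A decision problem is a set of words; an enumeration problem $E$ assigns to every word $x$ a set $E(x)$ of words (its solutions). The machines are random access machines with unit-cost steps (constants, addition, truncated subtraction, halving, indirect addressing, conditional jumps); on inputs $x$ all their register contents are required to have at most $p(|x|)$ binary digits for some polynomial $p$. An oracle machine has in addition an infinite sequence of query registers, into which it writes a word symbol by symbol, and one answer register, in which the answer appears in one step. - An oracle for a decision problem $L$ answers whether the submitted word is in $L$. An oracle for an enumeration problem $E$, asked a word $w$, answers with an arbitrary element of $E(w)$ that it has not yet given as an answer to $w$ in the current run, and with a special symbol $\bot$ if there is none left. - A machine enumerates an enumeration problem $B$ with polynomial delay if there is a polynomial $p$ such that, on every input $x$, it outputs exactly the elements of $B(x)$, each exactly once, and the time before the first output, between any two consecutive outputs, and between the last output and halting is at most $p(|x|)$. It is oracle-bounded if all oracle queries on input $x$ have length at most $p(|x|)$. - For a class $C$ of decision problems, $\mathrm{Del}C$ is the class of all enumeration problems that are enumerated with polynomial delay by an oracle-bounded machine with an oracle for some $L\in C$. - $B$ reduces to $E$ via D-reductions, $B\le_D E$, if there is an oracle-bounded machine that, with an oracle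 for the enumeration problem $E$, enumerates $B$ with polynomial delay, for every order in which the oracle may give its answers (with the same polynomial). $E$ is $\mathcal D$-hard under D-reductions if $B\le_D E$ for all $B\in\mathcal D$. - $\Sigma_k^p$ is the $k$-th level of the polynomial hierarchy ($\Sigma_0^p=\mathrm P$); a decision problem is $\Sigma_k^p$-hard if every problem in $\Sigma_k^p$ reduces to it by a polynomial-time many-one reduction. **Theorem.** Let $k\ge 0$, let $A$ be a $\Sigma_k^p$-hard decision problem, and let $E$ be an enumeration problem such that $A$ can be decided in polynomial time by a machine with access to an oracle for $E$ (correctly and within the time bound for every order of the oracle's answers). Then $E$ is $\mathrm{Del}\Sigma_k^p$-hard under D-reductions. -/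

import Mathlib

namespace EnumComplexity

/-- Words over the alphabet `{0, 1}`. -/
abbrev Word := List Bool

/-- A decision problem: the set of its yes-instances. -/
abbrev DecProblem := Set Word

/-- An enumeration problem: it assigns to every input the set of its solutions. -/
abbrev EnumProblem := Word → Set Word

/-! ### Random access machines with an oracle -/

/-- Instructions of a random access machine. `R` stands for the work registers, which hold natural
numbers. A machine also has read-only input cells, an infinite sequence of query registers (one
symbol per register), one answer register, and a write-only output medium. -/
inductive Instr where
  /-- `R i := n` -/
  | const (i n : ℕ)
  /-- `R i := R j + R k` -/
  | add (i j k : ℕ)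
  /-- `R i := R j - R k`, truncated at `0` -/
  | sub (i j k : ℕ)
  /-- `R i := ⌊R j / 2⌋` -/
  | half (i j : ℕ)
  /-- indirect read: `R i := R (R j)` -/
  | load (i j : ℕ)
  /-- indirect write: `R (R i) := R j` -/
  | store (i j : ℕ)
  /-- go to instruction `l` -/
  | jump (l : ℕ)
  /-- if `R i = 0` go to instruction `l` -/
  | jumpZero (i l : ℕ)
  /-- `R i :=` content of the input cell with address `R j` -/
  | input (i j : ℕ)
  /-- write the symbol with code `R j` into the query register with address `R i` -/
  | ask (i j : ℕ)
  /-- submit the word in the query registers to the oracle -/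
  | query
  /-- `R i :=` content of the answer register -/
  | answer (i : ℕ)
  /-- append the bit with code `R i` to the word that is being printed -/
  | print (i : ℕ)
  /-- the word printed so far is complete: it is output, and a new word is begun -/
  | output

/-- A program; the machine halts when the program counter leaves the program. -/
abbrev Program := List Instr

/-- Codes of symbols in registers: blank is `0`, the bit `0` is `1`, the bit `1` is `2`. -/
def symbolCode : Option Bool → ℕ
  | none => 0
  | some false => 1
  | some true => 2

/-- The symbol with a given code (numbers above `2` are read as `2`). -/
def codeSymbol : ℕ → Option Bool
  | 0 => none
  | 1 => some false
  | _ => some true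

/-- A word as the content of a single register: the binary number whose digits, from the lowest
one on, are the letters of the word, followed by a highest digit `1`. In particular it is not `0`. -/
def wordCode (w : Word) : ℕ :=
  w.foldr (fun b a => 2 * a + b.toNat) 1

/-- Oracles: `O w j` is the content of the answer register when the word `w` is submitted and has
been submitted exactly `j` times before in the run. -/
abbrev Oracle := Word → ℕ → ℕ

structure Config where
  /-- program counter -/
  pc : ℕ
  /-- work registers -/
  reg : ℕ → ℕ
  /-- query registers (`none` is blank) -/
  qreg : ℕ → Option Bool
  /-- answer register -/
  ans : ℕ
  /-- how often each word has been submitted to the oracle so far -/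
  asked : Word → ℕ
  /-- the word that is being printed -/
  out : Word

/-- The initial configuration: all registers are zero or blank. -/
def startConfig : Config where
  pc := 0
  reg := fun _ => 0
  qreg := fun _ => none
  ans := 0
  asked := fun _ => 0
  out := []

/-- The word in the query registers: the symbols before the first blank. (In a run only finitely
many query registers are not blank.) -/
noncomputable def Config.queryWord (c : Config) : Word :=
  (List.range (sInf {i : ℕ | c.qreg i = none})).map fun i => (c.qreg i).getD false

/-- Move on to the next instruction. -/
def Config.next (c : Config) : Config :=
  { c with pc := c.pc + 1 }

/-- Set a work register and move on to the next instruction. -/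
def Config.set (c : Config) (i v : ℕ) : Config :=
  { c with pc := c.pc + 1, reg := Function.update c.reg i v }

/-- The effect of one instruction on input `x` with oracle `O`. -/
noncomputable def Instr.exec (O : Oracle) (x : Word) (c : Config) : Instr → Config
  | .const i n => c.set i n
  | .add i j k => c.set i (c.reg j + c.reg k)
  | .sub i j k => c.set i (c.reg j - c.reg k)
  | .half i j => c.set i (c.reg j / 2)
  | .load i j => c.set i (c.reg (c.reg j))
  | .store i j => c.set (c.reg i) (c.reg j)
  | .jump l => { c with pc := l }
  | .jumpZero i l => if c.reg i = 0 then { c with pc := l } else c.next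
  | .input i j => c.set i (symbolCode x[c.reg j]?)
  | .ask i j => { c.next with qreg := Function.update c.qreg (c.reg i) (codeSymbol (c.reg j)) }
  | .query =>
      { c.next with
        ans := O c.queryWord (c.asked c.queryWord)
        asked := Function.update c.asked c.queryWord (c.asked c.queryWord + 1) }
  | .answer i => c.set i c.ans
  | .print i => { c.next with out := c.out ++ (codeSymbol (c.reg i)).toList }
  | .output => { c.next with out := [] }

/-- One step of the machine; a halted machine stays as it is. -/
noncomputable def step (M : Program) (O : Oracle) (x : Word) (c : Config) : Config :=
  match M[c.pc]? with
  | none => c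
  | some I => I.exec O x c

/-- The configuration after `t` steps on input `x`. -/
noncomputable def run (M : Program) (O : Oracle) (x : Word) (t : ℕ) : Config :=
  (step M O x)^[t] startConfig

/-- The machine has halted after at most `t` steps. -/
def HaltedAt (M : Program) (O : Oracle) (x : Word) (t : ℕ) : Prop :=
  M[(run M O x t).pc]? = none

/-- The instruction executed after `t` steps outputs the word `y`. -/
def OutputsAt (M : Program) (O : Oracle) (x : Word) (t : ℕ) (y : Word) : Prop :=
  M[(run M O x t).pc]? = some Instr.output ∧ (run M O x t).out = y

/-- The instruction executed after `t` steps submits the word `w` to the oracle. -/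
def QueriesAt (M : Program) (O : Oracle) (x : Word) (t : ℕ) (w : Word) : Prop :=
  M[(run M O x t).pc]? = some Instr.query ∧ (run M O x t).queryWord = w

/-- Throughout the run, all register contents have at most `d` binary digits. Steps have unit cost,
so this is the usual condition that keeps a random access machine from computing with numbers that
are too long. -/
def RegistersBounded (M : Program) (O : Oracle) (x : Word) (d : ℕ) : Prop :=
  ∀ t, (∀ i, ((run M O x t).reg i).size ≤ d) ∧ (run M O x t).ans.size ≤ d

/-- On input `x` the machine enumerates the set `S` without repetitions with delay at most `d`: the
time before the first output, between two consecutive outputs, and between the last output and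
halting is at most `d`. Register contents and oracle queries are bounded by `d` as well. -/
def EnumeratesWithin (M : Program) (O : Oracle) (x : Word) (S : Set Word) (d : ℕ) : Prop :=
  (∀ y, y ∈ S ↔ ∃ t, OutputsAt M O x t y) ∧
  (∀ t t' y, OutputsAt M O x t y → OutputsAt M O x t' y → t = t') ∧
  (∀ t, ∃ s, t ≤ s ∧ s ≤ t + d ∧ (HaltedAt M O x s ∨ ∃ y, OutputsAt M O x s y)) ∧
  (∀ t w, QueriesAt M O x t w → w.length ≤ d) ∧
  RegistersBounded M O x d

/-- On input `x` the machine halts within `d` steps, and it accepts (the register `R 0` is not `0`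
in the end) if and only if `accept` holds. -/
def DecidesWithin (M : Program) (O : Oracle) (x : Word) (accept : Prop) (d : ℕ) : Prop :=
  HaltedAt M O x d ∧ (accept ↔ (run M O x d).reg 0 ≠ 0) ∧ RegistersBounded M O x d

/-- On input `x` the machine halts within `d` steps, having printed the word `y`. -/
def ComputesWithin (M : Program) (O : Oracle) (x : Word) (y : Word) (d : ℕ) : Prop :=
  HaltedAt M O x d ∧ (run M O x d).out = y ∧ RegistersBounded M O x d

/-! ### Kinds of oracles -/

/-- The trivial oracle, which always answers `0`; machines with it are machines without oracle. -/
def noOracle : Oracle := fun _ _ => 0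

open Classical in
/-- The oracle for a decision problem. -/
noncomputable def decOracle (L : DecProblem) : Oracle :=
  fun w _ => if w ∈ L then 1 else 0

/-- An order in which an oracle for the enumeration problem `E` gives its answers: `a w j` is the
answer if `w` has been asked `j` times before. As long as there are solutions that were not given
before, the answer is one of them; otherwise it is the special symbol `none`. -/
def IsAnswerOrder (E : EnumProblem) (a : Word → ℕ → Option Word) : Prop :=
  ∀ w j,
    ((∃ y ∈ E w, ∀ i < j, a w i ≠ some y) →
      ∃ y ∈ E w, (∀ i < j, a w i ≠ some y) ∧ a w j = some y) ∧
    ((¬ ∃ y ∈ E w, ∀ i < j, a w i ≠ some y) → a w j = none)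

/-- The oracle for an enumeration problem with a given order of answers; the special symbol is
represented by `0`. -/
def enumOracle (a : Word → ℕ → Option Word) : Oracle :=
  fun w j => match a w j with
    | none => 0
    | some y => wordCode y

/-! ### Decision complexity classes -/

/-- The class P. -/
def classP : Set DecProblem :=
  {L | ∃ (M : Program) (p : Polynomial ℕ), ∀ x,
    DecidesWithin M noOracle x (x ∈ L) (p.eval x.length)}

/-- Encoding of pairs of words by words. -/
def pairWord (x y : Word) : Word :=
  (x.flatMap fun b => [true, b]) ++ false :: y

/-- The classes `Σₖᵖ` of the polynomial hierarchy: `Σ₀ᵖ = P`, and `L ∈ Σₖ₊₁ᵖ` if membership in `L`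
is a polynomially bounded existential quantifier in front of a `Πₖᵖ` predicate, where `Πₖᵖ` consists
of the complements of the problems in `Σₖᵖ`. -/
def SigmaP : ℕ → Set DecProblem
  | 0 => classP
  | k + 1 => {L | ∃ K : DecProblem, Kᶜ ∈ SigmaP k ∧ ∃ p : Polynomial ℕ, ∀ x,
      x ∈ L ↔ ∃ y : Word, y.length ≤ p.eval x.length ∧ pairWord x y ∈ K}

/-- Polynomial time many-one reducibility. -/
def PolyManyOneReducible (L A : DecProblem) : Prop :=
  ∃ f : Word → Word,
    (∃ (M : Program) (p : Polynomial ℕ), ∀ x,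
      ComputesWithin M noOracle x (f x) (p.eval x.length)) ∧
    ∀ x, x ∈ L ↔ f x ∈ A

/-- Hardness of a decision problem for a class under polynomial time many-one reductions. -/
def IsHard (C : Set DecProblem) (A : DecProblem) : Prop :=
  ∀ L ∈ C, PolyManyOneReducible L A

/-- `A` can be decided in polynomial time by a machine with access to an oracle for the enumeration
problem `E`, whatever the order of the oracle's answers. -/
def DecidableInPolyTimeWith (A : DecProblem) (E : EnumProblem) : Prop :=
  ∃ (M : Program) (p : Polynomial ℕ), ∀ a, IsAnswerOrder E a → ∀ x,
    DecidesWithin M (enumOracle a) x (x ∈ A) (p.eval x.length)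

/-! ### Enumeration complexity classes -/

/-- The class `Del C`: the problems that can be enumerated with polynomial delay by a random access
machine with an oracle from `C` and polynomially bounded oracle queries. -/
def Del (C : Set DecProblem) : Set EnumProblem :=
  {B | ∃ L ∈ C, ∃ (M : Program) (p : Polynomial ℕ), ∀ x,
    EnumeratesWithin M (decOracle L) x (B x) (p.eval x.length)}

/-- `B` reduces to `E` via D-reductions: an oracle-bounded enumeration oracle machine enumerates `B`
with polynomial delay using an oracle for `E`, whatever the order of the oracle's answers. -/
def DReducible (B E : EnumProblem) : Prop :=
  ∃ (M : Program) (p : Polynomial ℕ), ∀ a, IsAnswerOrder E a → ∀ x,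
    EnumeratesWithin M (enumOracle a) x (B x) (p.eval x.length)

/-- Hardness of an enumeration problem for a class under D-reductions. -/
def IsDHard (D : Set EnumProblem) (E : EnumProblem) : Prop :=
  ∀ B ∈ D, DReducible B E

end EnumComplexity

/-! Let `M` be an enumerator with an oracle for `L`, let `F` compute a reduction of `L` to `A`, and
let `D` decide `A` with the oracle for `E`. One simulates `M` step by step, and whenever `M` asks
for a word `w`, one computes `F(w)` and runs `D` on it. Three points need care.

The oracle for `E` does not repeat an answer, while every run of `D` has to start from a fresh
oracle. Hence all answers are cached: the `j`-th time a run of `D` asks for a word, it gets the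
`j`-th answer that the oracle ever gave to this word, and the oracle is asked only if that answer is
not in the cache yet.

The registers of `F` and `D` have to be cleared before each run, within a time that does not depend
on how much was written before, since `M` may run for exponentially long. Hence every entry
carries the number of the run in which it was written, and entries of earlier runs count as `0`.

The number of runs may be exponential, but the registers must stay of polynomial length. As `M`
outputs distinct words of polynomial length with polynomial delay, it makes at most exponentially
many steps, so the number of the current run has polynomially many digits. -/

namespace EnumComplexity

/-! ### Quiet runs -/

/-- The next instruction outputs nothing, and if it is a query, then the word that is asked and the
answer are of length at most `d`. -/
def Quiet (M : Program) (O : Oracle) (d : ℕ) (c : Config) : Prop :=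
  M[c.pc]? ≠ some Instr.output ∧
    (M[c.pc]? = some Instr.query →
      c.queryWord.length ≤ d ∧ (O c.queryWord (c.asked c.queryWord)).size ≤ d)

/-- The machine gets from `c` to `c'` in at most `n` steps, all of which are quiet. -/
def QuietRun (M : Program) (O : Oracle) (x : Word) (d : ℕ) (c : Config) (n : ℕ) (c' : Config) :
    Prop :=
  ∃ m ≤ n, (step M O x)^[m] c = c' ∧ ∀ i < m, Quiet M O d ((step M O x)^[i] c)

/-- Instructions that move on to the next one, without query or output. -/
def Instr.Basic : Instr → Prop
  | .jump _ => False
  | .jumpZero _ _ => False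
  | .query => False
  | .output => False
  | _ => True

/-- The instructions `l` stand in the program `M` from position `b` on. -/
def CodeAt (M : Program) (b : ℕ) (l : List Instr) : Prop :=
  ∀ i < l.length, M[b + i]? = l[i]?

section
variable {M : Program} {O : Oracle} {x : Word} {d : ℕ} {c c' c'' : Config} {n n' : ℕ}

theorem QuietRun.refl (c : Config) : QuietRun M O x d c 0 c :=
  ⟨0, le_rfl, rfl, by simp⟩

theorem QuietRun.mono (h : QuietRun M O x d c n c') (hn : n ≤ n') : QuietRun M O x d c n' c' := by
  obtain ⟨m, hm, h⟩ := h
  exact ⟨m, hm.trans hn, h⟩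

theorem QuietRun.congr (h : QuietRun M O x d c n c') (hn : n ≤ n') (hc : c' = c'') :
    QuietRun M O x d c n' c'' :=
  hc ▸ h.mono hn

theorem QuietRun.trans (h : QuietRun M O x d c n c') (h' : QuietRun M O x d c' n' c'') :
    QuietRun M O x d c (n + n') c'' := by
  obtain ⟨m, hm, rfl, hq⟩ := h
  obtain ⟨m', hm', rfl, hq'⟩ := h'
  refine ⟨m' + m, by omega, by rw [Function.iterate_add_apply], fun i hi => ?_⟩
  rcases lt_or_ge i m with h | h
  · exact hq i h
  · obtain ⟨j, rfl⟩ := Nat.exists_eq_add_of_le' h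
    rw [Function.iterate_add_apply]
    exact hq' j (by omega)

theorem QuietRun.single {I : Instr} (hI : M[c.pc]? = some I) (hq : Quiet M O d c) :
    QuietRun M O x d c 1 (I.exec O x c) := by
  refine ⟨1, le_rfl, by simp [step, hI], fun i hi => ?_⟩
  obtain rfl : i = 0 := by omega
  exact hq

theorem Quiet.of_ne {I : Instr} (hI : M[c.pc]? = some I) (h : I ≠ .query) (h' : I ≠ .output) :
    Quiet M O d c := by
  simp [Quiet, hI, h, h']

theorem QuietRun.jump {l : ℕ} (hM : M[c.pc]? = some (.jump l)) :
    QuietRun M O x d c 1 { c with pc := l } :=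
  .single hM (.of_ne hM (by simp) (by simp))

theorem QuietRun.jumpZero {i l : ℕ} (hM : M[c.pc]? = some (.jumpZero i l)) :
    QuietRun M O x d c 1 (if c.reg i = 0 then { c with pc := l } else c.next) :=
  .single hM (.of_ne hM (by simp) (by simp))

theorem QuietRun.const {i n : ℕ} (hM : M[c.pc]? = some (.const i n)) :
    QuietRun M O x d c 1 (c.set i n) :=
  .single hM (.of_ne hM (by simp) (by simp))

theorem Instr.Basic.pc_exec {I : Instr} (h : I.Basic) (c : Config) :
    (I.exec O x c).pc = c.pc + 1 := by
  cases I <;> first | exact h.elim | rfl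

theorem codeAt_cons {b : ℕ} {I : Instr} {l : List Instr} :
    CodeAt M b (I :: l) ↔ M[b]? = some I ∧ CodeAt M (b + 1) l := by
  constructor
  · intro h
    refine ⟨by simpa using h 0 (by simp), fun i hi => ?_⟩
    have := h (i + 1) (by simpa using hi)
    rw [show b + 1 + i = b + (i + 1) by ring, this]
    simp
  · rintro ⟨h, h'⟩ i hi
    rcases i with _ | i
    · simpa using h
    · have := h' i (by simpa using hi)
      rw [show b + (i + 1) = b + 1 + i by ring, this]
      simp

theorem codeAt_append {b : ℕ} {l l' : List Instr} :
    CodeAt M b (l ++ l') ↔ CodeAt M b l ∧ CodeAt M (b + l.length) l' := by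
  induction l generalizing b with
  | nil => simp [CodeAt]
  | cons I l ih =>
    rw [List.cons_append, codeAt_cons, ih, codeAt_cons, List.length_cons,
      show b + 1 + l.length = b + (l.length + 1) by ring, and_assoc]

theorem QuietRun.basic {l : List Instr} (hl : ∀ I ∈ l, I.Basic) (hc : CodeAt M c.pc l) :
    QuietRun M O x d c l.length (l.foldl (fun c I => I.exec O x c) c) := by
  induction l generalizing c with
  | nil => exact QuietRun.refl c
  | cons I l ih =>
    rw [codeAt_cons] at hc
    have hI := hl I (by simp)
    have hfirst : QuietRun M O x d c 1 (I.exec O x c) :=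
      .single hc.1 (.of_ne hc.1 (by rintro rfl; exact hI) (by rintro rfl; exact hI))
    have hrest := ih (c := I.exec O x c) (fun J hJ => hl J (by simp [hJ]))
      (by rw [hI.pc_exec]; exact hc.2)
    exact (hfirst.trans hrest).mono (by simp; omega)

end

/-! ### A structured language -/

/-- The store of a structured program, which has arrays of numbers, indexed by `A`, in place of the
work registers. -/
structure State (A : Type) where
  /-- the arrays -/
  mem : A → ℕ → ℕ
  /-- query registers -/
  qreg : ℕ → Option Bool
  /-- answer register -/
  ans : ℕ
  /-- how often each word has been submitted to the oracle -/
  asked : Word → ℕ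
  /-- the word that is being printed -/
  out : Word

/-- Change of an array entry. -/
def State.set {A : Type} [DecidableEq A] (s : State A) (r : A) (i v : ℕ) : State A :=
  { s with mem := Function.update s.mem r (Function.update (s.mem r) i v) }

@[simp]
theorem State.mem_set {A : Type} [DecidableEq A] (s : State A) (r r' : A) (i i' v : ℕ) :
    (s.set r i v).mem r' i' = if r' = r ∧ i' = i then v else s.mem r' i' := by
  by_cases h : r' = r
  · subst h
    simp [State.set, Function.update_apply]
  · simp [State.set, h]

section
variable {A : Type} [Fintype A]

/-- The address of the work register that holds entry `i` of array `r`. The arrays are interleaved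
with a stride that is a power of two, so that addresses can be computed by doubling. -/
noncomputable def addr (r : A) (i : ℕ) : ℕ :=
  2 ^ Fintype.card A * i + (Fintype.equivFin A r + 1)

variable (A) in
/-- The address of the `k`-th work register for intermediate results. -/
def temp (k : ℕ) : ℕ :=
  2 ^ Fintype.card A * k

theorem addr_mod (r : A) (i : ℕ) : addr r i % 2 ^ Fintype.card A = Fintype.equivFin A r + 1 := by
  have hlt : (Fintype.equivFin A r : ℕ) + 1 < 2 ^ Fintype.card A :=
    (Nat.succ_le_of_lt (Fintype.equivFin A r).2).trans_lt Nat.lt_two_pow_self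
  rw [addr, Nat.mul_add_mod, Nat.mod_eq_of_lt hlt]

theorem addr_injective : Function.Injective fun p : A × ℕ => addr p.1 p.2 := by
  rintro ⟨r, i⟩ ⟨r', i'⟩ (h : addr r i = addr r' i')
  obtain rfl : r = r' := by
    have hmod := congrArg (· % 2 ^ Fintype.card A) h
    simp only [addr_mod, Nat.add_right_cancel_iff] at hmod
    exact (Fintype.equivFin A).injective (Fin.ext hmod)
  simpa [addr] using h

theorem addr_ne_temp (r : A) (i k : ℕ) : addr r i ≠ temp A k := by
  intro h
  have hmod := addr_mod r i
  rw [h, temp, Nat.mul_mod_right] at hmod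
  omega

theorem temp_inj {k k' : ℕ} : temp A k = temp A k' ↔ k = k' := by
  simp [temp]

namespace State

/-- The work registers that represent the arrays; the registers for intermediate results hold
`0`. -/
noncomputable def phys (s : State A) : ℕ → ℕ :=
  Function.extend (fun p : A × ℕ => addr p.1 p.2) (fun p => s.mem p.1 p.2) 0

/-- The configuration with the work registers `R` and everything else as in `s`. -/
def withReg (s : State A) (pc : ℕ) (R : ℕ → ℕ) : Config :=
  ⟨pc, R, s.qreg, s.ans, s.asked, s.out⟩

/-- The configuration that represents `s`. -/
noncomputable def config (s : State A) (pc : ℕ) : Config :=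
  s.withReg pc s.phys

/-- The word in the query registers. -/
noncomputable def queryWord (s : State A) : Word := (s.config 0).queryWord

theorem phys_addr (s : State A) (r : A) (i : ℕ) : s.phys (addr r i) = s.mem r i :=
  addr_injective.extend_apply _ _ (r, i)

theorem phys_of_ne (s : State A) {a : ℕ} (h : ∀ (r : A) i, addr r i ≠ a) : s.phys a = 0 :=
  Function.extend_apply' _ _ _ fun ⟨p, hp⟩ => h p.1 p.2 hp

theorem phys_set [DecidableEq A] (s : State A) (r : A) (i v : ℕ) :
    (s.set r i v).phys = Function.update s.phys (addr r i) v := by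
  funext a
  by_cases ha : ∃ (r' : A) (i' : ℕ), addr r' i' = a
  · obtain ⟨r', i', rfl⟩ := ha
    have hinj : addr r' i' = addr r i ↔ r' = r ∧ i' = i :=
      (addr_injective.eq_iff (a := (r', i')) (b := (r, i))).trans Prod.mk_inj
    simp only [phys_addr, mem_set, Function.update_apply, hinj]
  · push Not at ha
    rw [Function.update_of_ne (ha r i).symm, phys_of_ne _ ha, phys_of_ne _ ha]

end State

/-- Registers that represent the arrays of `s`, where the temporary registers from number `k` on are
zero: what the evaluation of an expression into the `k`-th temporary register starts from. -/
structure Fits (s : State A) (k : ℕ) (R : ℕ → ℕ) : Prop where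
  mem : ∀ (r : A) i, R (addr r i) = s.mem r i
  zero : ∀ j ≥ k, R (temp A j) = 0

theorem State.fits (s : State A) : Fits s 0 s.phys :=
  ⟨s.phys_addr, fun j _ => s.phys_of_ne fun r i => addr_ne_temp r i j⟩

theorem Fits.update {s : State A} {k : ℕ} {R : ℕ → ℕ} (h : Fits s k R) (v : ℕ) :
    Fits s (k + 1) (Function.update R (temp A k) v) where
  mem r i := by
    rw [Function.update_of_ne (addr_ne_temp r i k), h.mem]
  zero j hj := by
    rw [Function.update_of_ne (by rw [Ne, temp_inj]; omega), h.zero j (by omega)]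

theorem Fits.update_zero {s : State A} {k : ℕ} {R : ℕ → ℕ} (h : Fits s k R) :
    Function.update R (temp A k) 0 = R :=
  Function.update_eq_self_iff.2 (h.zero k le_rfl).symm

theorem Fits.update_restore {s : State A} {k : ℕ} {R : ℕ → ℕ} (h : Fits s k R) (u v w : ℕ) :
    Function.update (Function.update (Function.update (Function.update R (temp A k) u)
      (temp A (k + 1)) w) (temp A k) v) (temp A (k + 1)) 0 = Function.update R (temp A k) v := by
  have hne : temp A k ≠ temp A (k + 1) := by simp [temp_inj]
  have hzero := h.zero (k + 1) (by omega)
  funext a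
  simp only [Function.update_apply]
  grind

theorem State.update_phys_temps (s : State A) (u v : ℕ) :
    Function.update (Function.update (Function.update (Function.update s.phys (temp A 0) u)
      (temp A 1) v) (temp A 1) 0) (temp A 0) 0 = s.phys := by
  have hone := (s.fits.update u).update_zero
  rw [zero_add] at hone
  rw [Function.update_idem, hone, Function.update_idem, s.fits.update_zero]

end

/-- Arithmetic expressions over the arrays, the input and the answer register. -/
inductive Expr (A : Type) where
  | const (n : ℕ)
  | add (e f : Expr A)
  | sub (e f : Expr A)
  | half (e : Expr A)
  /-- array entry -/
  | mem (r : A) (e : Expr A)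
  /-- input symbol -/
  | input (e : Expr A)
  /-- the content of the answer register -/
  | ans
  /-- the value of `e` if `c` is not zero, the value of `f` otherwise -/
  | cond (c e f : Expr A)

namespace Expr

/-- The value of an expression. -/
@[simp]
def eval {A : Type} (x : Word) (s : State A) : Expr A → ℕ
  | const n => n
  | add e f => e.eval x s + f.eval x s
  | sub e f => e.eval x s - f.eval x s
  | half e => e.eval x s / 2
  | mem r e => s.mem r (e.eval x s)
  | input e => symbolCode x[e.eval x s]?
  | ans => s.ans
  | cond c e f => if c.eval x s = 0 then f.eval x s else e.eval x s

variable {A : Type} [Fintype A]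

/-- The length of the code of an expression. -/
def cost : Expr A → ℕ
  | const _ => 1
  | add e f => e.cost + f.cost + 2
  | sub e f => e.cost + f.cost + 2
  | half e => e.cost + 1
  | mem _ e => e.cost + Fintype.card A + 4
  | input e => e.cost + 1
  | ans => 1
  | cond c e f => c.cost + e.cost + f.cost + 3

/-- Instructions that turn the index of an entry of array `r`, in the `k`-th temporary register,
into the address of this entry. -/
noncomputable def addrCode (r : A) (k : ℕ) : List Instr :=
  List.replicate (Fintype.card A) (.add (temp A k) (temp A k) (temp A k)) ++
    [.const (temp A (k + 1)) (Fintype.equivFin A r + 1),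
      .add (temp A k) (temp A k) (temp A (k + 1)), .const (temp A (k + 1)) 0]

/-- Instructions at position `b` that store the value of an expression in the `k`-th temporary
register and use higher ones for intermediate results. -/
noncomputable def code : Expr A → ℕ → ℕ → List Instr
  | const n, k, _ => [.const (temp A k) n]
  | add e f, k, b => e.code k b ++ (f.code (k + 1) (b + e.cost) ++
      [.add (temp A k) (temp A k) (temp A (k + 1)), .const (temp A (k + 1)) 0])
  | sub e f, k, b => e.code k b ++ (f.code (k + 1) (b + e.cost) ++
      [.sub (temp A k) (temp A k) (temp A (k + 1)), .const (temp A (k + 1)) 0])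
  | half e, k, b => e.code k b ++ [.half (temp A k) (temp A k)]
  | mem r e, k, b => e.code k b ++ (addrCode r k ++ [.load (temp A k) (temp A k)])
  | input e, k, b => e.code k b ++ [.input (temp A k) (temp A k)]
  | ans, k, _ => [.answer (temp A k)]
  | cond c e f, k, b =>
      (c.code k b ++ [.jumpZero (temp A k) (b + c.cost + 2 + e.cost + 1), .const (temp A k) 0]) ++
        (e.code k (b + c.cost + 2) ++ ([.jump (b + c.cost + e.cost + f.cost + 3)] ++
          f.code k (b + c.cost + 2 + e.cost + 1)))

theorem length_addrCode (r : A) (k : ℕ) : (addrCode r k).length = Fintype.card A + 3 := by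
  simp [addrCode]

theorem length_code (e : Expr A) (k b : ℕ) : (e.code k b).length = e.cost := by
  induction e generalizing k b <;> simp_all [code, cost, length_addrCode] <;> omega

variable {M : Program} {O : Oracle} {x : Word} {d : ℕ} {s : State A} {k b : ℕ} {R : ℕ → ℕ}

/-- The code of `e`, wherever it stands in `M`, computes the value of `e` in the state `s`. -/
def Correct (M : Program) (O : Oracle) (x : Word) (d : ℕ) (s : State A) (e : Expr A) : Prop :=
  ∀ ⦃k b R⦄, Fits s k R → CodeAt M b (e.code k b) →
    QuietRun M O x d (s.withReg b R) e.cost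
      (s.withReg (b + e.cost) (Function.update R (temp A k) (e.eval x s)))

theorem quietRun_unary {e : Expr A} (he : e.Correct M O x d s) {I : Instr} {v : ℕ}
    (hI : I.Basic) (hexec : ∀ c : Config, c.reg (temp A k) = e.eval x s →
      I.exec O x c = c.set (temp A k) v)
    (hR : Fits s k R) (hM : CodeAt M b (e.code k b ++ [I])) :
    QuietRun M O x d (s.withReg b R) (e.cost + 1)
      (s.withReg (b + (e.cost + 1)) (Function.update R (temp A k) v)) := by
  rw [codeAt_append, length_code] at hM
  refine ((he hR hM.1).trans (.basic (by simpa using hI) hM.2)).congr le_rfl ?_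
  rw [List.foldl_cons, List.foldl_nil, hexec _ (by simp [State.withReg])]
  simp [State.withReg, Config.set, add_assoc]

theorem quietRun_binary {e f : Expr A} (he : e.Correct M O x d s) (hf : f.Correct M O x d s)
    {I : Instr} {v : ℕ} (hI : I.Basic)
    (hexec : ∀ c : Config, c.reg (temp A k) = e.eval x s → c.reg (temp A (k + 1)) = f.eval x s →
      I.exec O x c = c.set (temp A k) v)
    (hR : Fits s k R) (hM : CodeAt M b (e.code k b ++ (f.code (k + 1) (b + e.cost) ++
      [I, .const (temp A (k + 1)) 0]))) :
    QuietRun M O x d (s.withReg b R) (e.cost + f.cost + 2)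
      (s.withReg (b + (e.cost + f.cost + 2)) (Function.update R (temp A k) v)) := by
  have hne : temp A k ≠ temp A (k + 1) := by simp [temp_inj]
  rw [codeAt_append, codeAt_append, length_code, length_code] at hM
  refine (((he hR hM.1).trans (hf (hR.update _) hM.2.1)).trans
    (.basic (by simpa using ⟨hI, trivial⟩) hM.2.2)).congr le_rfl ?_
  rw [List.foldl_cons, hexec _ (by simp [State.withReg, hne]) (by simp [State.withReg])]
  simp only [State.withReg, Config.set, Instr.exec, List.foldl_cons, List.foldl_nil,
    hR.update_restore, Config.mk.injEq, and_true]
  omega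

theorem quietRun_double (n v : ℕ)
    (hM : CodeAt M b (List.replicate n (.add (temp A k) (temp A k) (temp A k)))) :
    QuietRun M O x d (s.withReg b (Function.update R (temp A k) v)) n
      (s.withReg (b + n) (Function.update R (temp A k) (2 ^ n * v))) := by
  induction n generalizing b v with
  | zero => simpa using QuietRun.refl _
  | succ n ih =>
    rw [List.replicate_succ, codeAt_cons] at hM
    have hfirst : QuietRun M O x d (s.withReg b (Function.update R (temp A k) v)) 1
        (s.withReg (b + 1) (Function.update R (temp A k) (v + v))) := by
      refine (QuietRun.single hM.1 (.of_ne hM.1 (by simp) (by simp))).congr le_rfl ?_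
      simp [State.withReg, Instr.exec, Config.set]
    refine (hfirst.trans (ih (v + v) hM.2)).congr (by omega) ?_
    rw [show b + 1 + n = b + (n + 1) by ring, show 2 ^ n * (v + v) = 2 ^ (n + 1) * v by ring]

theorem quietRun_addrCode (r : A) (i : ℕ) (hR : Fits s k R)
    (hM : CodeAt M b (addrCode r k)) :
    QuietRun M O x d (s.withReg b (Function.update R (temp A k) i)) (Fintype.card A + 3)
      (s.withReg (b + (Fintype.card A + 3)) (Function.update R (temp A k) (addr r i))) := by
  have hne : temp A k ≠ temp A (k + 1) := by simp [temp_inj]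
  rw [addrCode, codeAt_append, List.length_replicate] at hM
  refine ((quietRun_double _ i hM.1).trans (.basic (by simp [Instr.Basic]) hM.2)).congr le_rfl ?_
  simp only [List.foldl_cons, List.foldl_nil, Instr.exec, Config.set, State.withReg,
    Function.update_self, Function.update_of_ne hne, hR.update_restore, addr, add_assoc,
    Nat.reduceAdd]

theorem quietRun_test {e : Expr A} (he : e.Correct M O x d s) {l : ℕ} (hR : Fits s k R)
    (hM : CodeAt M b (e.code k b ++ [.jumpZero (temp A k) l, .const (temp A k) 0])) :
    QuietRun M O x d (s.withReg b R) (e.cost + 2)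
      (s.withReg (if e.eval x s = 0 then l else b + e.cost + 2) R) := by
  rw [codeAt_append, length_code, codeAt_cons, codeAt_cons] at hM
  have heval := he hR hM.1
  have hjump := heval.trans (.jumpZero hM.2.1)
  simp only [State.withReg, Function.update_self] at hjump
  split_ifs with h0
  · rw [if_pos h0, h0, hR.update_zero] at hjump
    exact hjump.mono (by omega)
  · rw [if_neg h0] at hjump
    refine (hjump.trans (.const hM.2.2.1)).congr le_rfl ?_
    simp [Config.next, Config.set, State.withReg, hR.update_zero]

theorem correct_mem {e : Expr A} (he : e.Correct M O x d s) (r : A) :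
    (mem r e).Correct M O x d s := by
  intro k b R hR hM
  rw [code, codeAt_append, codeAt_append, length_code, length_addrCode] at hM
  refine (((he hR hM.1).trans (quietRun_addrCode r _ hR hM.2.1)).trans
    (.basic (by simp [Instr.Basic]) hM.2.2)).congr le_rfl ?_
  simp only [List.foldl_cons, List.foldl_nil, Instr.exec, Config.set, State.withReg,
    Function.update_self, Function.update_of_ne (addr_ne_temp r _ k), hR.mem,
    Function.update_idem, cost, eval, Config.mk.injEq, and_true]
  omega

theorem correct_cond {c e f : Expr A} (hc : c.Correct M O x d s) (he : e.Correct M O x d s)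
    (hf : f.Correct M O x d s) : (cond c e f).Correct M O x d s := by
  intro k b R hR hM
  obtain ⟨hM_test, hM⟩ := codeAt_append.1 hM
  rw [codeAt_append, List.length_append, length_code, length_code, List.singleton_append,
    codeAt_cons] at hM
  obtain ⟨hM_e, hM_jump, hM_f⟩ := hM
  have htest := quietRun_test hc hR hM_test
  split_ifs at htest with h0
  · refine (htest.trans (hf hR hM_f)).congr (by simp only [cost]; omega) ?_
    simp only [State.withReg, eval, h0, if_true, cost, Config.mk.injEq, and_true]
    omega
  · refine ((htest.trans (he hR hM_e)).trans (.jump hM_jump)).congr (by simp only [cost]; omega) ?_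
    simp only [State.withReg, eval, h0, if_false, cost, Config.mk.injEq, and_true]
    omega

theorem correct (e : Expr A) : e.Correct M O x d s := by
  induction e with
  | const n => exact fun k b R _ hM => .basic (c := s.withReg b R) (by simp [Instr.Basic, code]) hM
  | ans => exact fun k b R _ hM => .basic (c := s.withReg b R) (by simp [Instr.Basic, code]) hM
  | add e f he hf =>
    exact fun k b R => quietRun_binary he hf trivial fun c h h' => by simp [Instr.exec, h, h', eval]
  | sub e f he hf =>
    exact fun k b R => quietRun_binary he hf trivial fun c h h' => by simp [Instr.exec, h, h', eval]
  | half e he =>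
    exact fun k b R => quietRun_unary he trivial fun c h => by simp [Instr.exec, h, eval]
  | input e he =>
    exact fun k b R => quietRun_unary he trivial fun c h => by simp [Instr.exec, h, eval]
  | mem r e he => exact correct_mem he r
  | cond c e f hc he hf => exact correct_cond hc he hf

end Expr

/-- Commands of a structured language that is compiled to machine code. -/
inductive Cmd (A : Type) where
  | skip
  /-- array entry `r[e] := f` -/
  | write (r : A) (e f : Expr A)
  | ask (e f : Expr A)
  | query
  | print (e : Expr A)
  | seq (c c' : Cmd A)
  /-- execute `c` if the value of `e` is not zero, and `c'` otherwise -/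
  | ite (e : Expr A) (c c' : Cmd A)
  /-- repeat `c` as long as the value of `e` is not zero -/
  | loop (e : Expr A) (c : Cmd A)

namespace Cmd

variable {A : Type} [Fintype A]

/-- The length of the code of a command; it bounds the running time if there is no loop. -/
def cost : Cmd A → ℕ
  | skip => 0
  | write _ e f => e.cost + f.cost + Fintype.card A + 6
  | ask e f => e.cost + f.cost + 3
  | query => 1
  | print e => e.cost + 2
  | seq c c' => c.cost + c'.cost
  | ite e c c' => e.cost + c.cost + c'.cost + 3
  | loop e c => e.cost + c.cost + 3

/-- Instructions at position `b` that execute a command. -/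
noncomputable def code : Cmd A → ℕ → List Instr
  | skip, _ => []
  | write r e f, b => f.code 0 b ++ (e.code 1 (b + f.cost) ++ (Expr.addrCode r 1 ++
      [.store (temp A 1) (temp A 0), .const (temp A 1) 0, .const (temp A 0) 0]))
  | ask e f, b => e.code 0 b ++ (f.code 1 (b + e.cost) ++
      [.ask (temp A 0) (temp A 1), .const (temp A 1) 0, .const (temp A 0) 0])
  | query, _ => [.query]
  | print e, b => e.code 0 b ++ [.print (temp A 0), .const (temp A 0) 0]
  | seq c c', b => c.code b ++ c'.code (b + c.cost)
  | ite e c c', b =>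
      (e.code 0 b ++ [.jumpZero (temp A 0) (b + e.cost + 2 + c.cost + 1), .const (temp A 0) 0]) ++
        (c.code (b + e.cost + 2) ++ ([.jump (b + e.cost + c.cost + c'.cost + 3)] ++
          c'.code (b + e.cost + 2 + c.cost + 1)))
  | loop e c, b =>
      (e.code 0 b ++ [.jumpZero (temp A 0) (b + e.cost + c.cost + 3), .const (temp A 0) 0]) ++
        (c.code (b + e.cost + 2) ++ [.jump b])

theorem length_code (c : Cmd A) (b : ℕ) : (c.code b).length = c.cost := by
  induction c generalizing b <;>
    simp_all [code, cost, Expr.length_code, Expr.length_addrCode] <;> omega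

end Cmd

/-- With oracle `O`, the command `c` leads from `s` to `s'` within `n` quiet steps. -/
def Exec {A : Type} [Fintype A] (O : Oracle) (x : Word) (d : ℕ) (c : Cmd A) (s : State A) (n : ℕ)
    (s' : State A) : Prop :=
  ∀ (M : Program) (b : ℕ), CodeAt M b (c.code b) →
    QuietRun M O x d (s.config b) n (s'.config (b + c.cost))

namespace Exec

variable {A : Type} [Fintype A] {O : Oracle} {x : Word} {d : ℕ} {s s' s'' : State A} {n n' : ℕ}
  {c c' : Cmd A} {e f : Expr A}

theorem mono (h : Exec O x d c s n s') (hn : n ≤ n') : Exec O x d c s n' s' :=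
  fun M b hM => (h M b hM).mono hn

theorem skip : Exec O x d .skip s 0 s := fun _ _ _ => QuietRun.refl _

theorem write [DecidableEq A] {r : A} {i v : ℕ} (he : e.eval x s = i) (hf : f.eval x s = v) :
    Exec O x d (.write r e f) s (Cmd.write r e f).cost (s.set r i v) := by
  subst he hf
  intro M b hM
  rw [Cmd.code, codeAt_append, codeAt_append, codeAt_append, Expr.length_code, Expr.length_code,
    Expr.length_addrCode] at hM
  obtain ⟨hM_f, hM_e, hM_addr, hM_store⟩ := hM
  have hfits := s.fits.update (f.eval x s)
  refine ((((f.correct s.fits hM_f).trans (e.correct hfits hM_e)).trans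
    (Expr.quietRun_addrCode r _ hfits hM_addr)).trans
    (.basic (by simp [Instr.Basic]) hM_store)).congr (by simp [Cmd.cost]; omega) ?_
  have hne : temp A 0 ≠ temp A 1 := by simp [temp_inj]
  have hne_addr : ∀ k, temp A k ≠ addr r (e.eval x s) := fun k => (addr_ne_temp _ _ k).symm
  simp only [zero_add, List.foldl_cons, List.foldl_nil, Instr.exec, Config.set, State.withReg,
    Function.update_self, Function.update_of_ne hne, Function.update_comm (hne_addr _)]
  rw [← State.phys_set, State.update_phys_temps]
  simp only [State.config, State.withReg, State.set, Cmd.cost, Config.mk.injEq, and_true]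
  omega

theorem ask {i : ℕ} {b : Option Bool} (he : e.eval x s = i) (hf : codeSymbol (f.eval x s) = b) :
    Exec O x d (.ask e f) s (Cmd.ask e f).cost { s with qreg := Function.update s.qreg i b } := by
  subst he hf
  intro M b hM
  rw [Cmd.code, codeAt_append, codeAt_append, Expr.length_code, Expr.length_code] at hM
  refine (((e.correct s.fits hM.1).trans (f.correct (s.fits.update _) hM.2.1)).trans
    (.basic (by simp [Instr.Basic]) hM.2.2)).congr (by simp [Cmd.cost]) ?_
  have hne : temp A 0 ≠ temp A 1 := by simp [temp_inj]
  simp only [List.foldl_cons, List.foldl_nil, Instr.exec, Config.set, Config.next, State.withReg,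
    zero_add, Function.update_self, Function.update_of_ne hne, State.update_phys_temps,
    State.config, Cmd.cost, Config.mk.injEq, and_true]
  exact ⟨by omega, rfl⟩

theorem query (h : s.queryWord.length ≤ d)
    (h' : (O s.queryWord (s.asked s.queryWord)).size ≤ d) :
    Exec O x d .query s 1
      { s with
        ans := O s.queryWord (s.asked s.queryWord)
        asked := Function.update s.asked s.queryWord (s.asked s.queryWord + 1) } := by
  intro M b hM
  rw [Cmd.code, codeAt_cons] at hM
  exact QuietRun.single (c := s.config b) hM.1 ⟨by simp [State.config, State.withReg, hM.1],
    fun _ => ⟨h, h'⟩⟩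

theorem print {b : Option Bool} (he : codeSymbol (e.eval x s) = b) :
    Exec O x d (.print e) s (Cmd.print e).cost { s with out := s.out ++ b.toList } := by
  subst he
  intro M b hM
  rw [Cmd.code, codeAt_append, Expr.length_code] at hM
  refine ((e.correct s.fits hM.1).trans (.basic (by simp [Instr.Basic]) hM.2)).congr
    (by simp [Cmd.cost]) ?_
  simp only [List.foldl_cons, List.foldl_nil, Instr.exec, Config.set, Config.next, State.withReg,
    Function.update_self, Function.update_idem, s.fits.update_zero, State.config, Cmd.cost,
    Config.mk.injEq, and_true]
  exact ⟨by omega, rfl⟩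

theorem seq (h : Exec O x d c s n s') (h' : Exec O x d c' s' n' s'') :
    Exec O x d (.seq c c') s (n + n') s'' := by
  intro M b hM
  rw [Cmd.code, codeAt_append, Cmd.length_code] at hM
  have := (h M _ hM.1).trans (h' M _ hM.2)
  rwa [add_assoc] at this

theorem ite_true (he : e.eval x s ≠ 0) (h : Exec O x d c s n s') :
    Exec O x d (.ite e c c') s (e.cost + n + 3) s' := by
  intro M b hM
  obtain ⟨hM_test, hM⟩ := codeAt_append.1 hM
  rw [codeAt_append, List.length_append, Expr.length_code, Cmd.length_code, List.singleton_append,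
    codeAt_cons] at hM
  have htest := Expr.quietRun_test (O := O) (x := x) (d := d) e.correct s.fits hM_test
  rw [if_neg he] at htest
  refine ((htest.trans (h M _ hM.1)).trans (.jump hM.2.1)).congr (by omega) ?_
  simp only [State.config, State.withReg, Cmd.cost, Config.mk.injEq, and_true]
  omega

theorem ite_false (he : e.eval x s = 0) (h : Exec O x d c' s n s') :
    Exec O x d (.ite e c c') s (e.cost + n + 3) s' := by
  intro M b hM
  obtain ⟨hM_test, hM⟩ := codeAt_append.1 hM
  rw [codeAt_append, List.length_append, Expr.length_code, Cmd.length_code, List.singleton_append,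
    codeAt_cons] at hM
  have htest := Expr.quietRun_test (O := O) (x := x) (d := d) e.correct s.fits hM_test
  rw [if_pos he] at htest
  refine (htest.trans (h M _ hM.2.2)).congr (by omega) ?_
  simp only [State.config, State.withReg, Cmd.cost, Config.mk.injEq, and_true]
  omega

theorem loop_exit (he : e.eval x s = 0) : Exec O x d (.loop e c) s (e.cost + 2) s := by
  intro M b hM
  have htest := Expr.quietRun_test (O := O) (x := x) (d := d) e.correct s.fits
    (codeAt_append.1 hM).1
  rw [if_pos he] at htest
  exact htest.congr le_rfl (by simp only [State.config, Cmd.cost, add_assoc])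

theorem loop_step (he : e.eval x s ≠ 0) (h : Exec O x d c s n s')
    (h' : Exec O x d (.loop e c) s' n' s'') :
    Exec O x d (.loop e c) s (e.cost + n + 3 + n') s'' := by
  intro M b hM
  have hloop := h' M b hM
  obtain ⟨hM_test, hM⟩ := codeAt_append.1 hM
  rw [codeAt_append, List.length_append, Expr.length_code, Cmd.length_code, codeAt_cons] at hM
  have htest := Expr.quietRun_test (O := O) (x := x) (d := d) e.correct s.fits hM_test
  rw [if_neg he] at htest
  exact (((htest.trans (h M _ hM.1)).trans (.jump hM.2.1)).trans hloop).mono (by omega)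

end Exec

section
variable {A : Type}

/-- Arrays also serve as scalar variables; the value is the entry at index `0`. -/
abbrev Expr.var (r : A) : Expr A := .mem r (.const 0)

/-- Assignment to a scalar variable. -/
abbrev Cmd.assign (r : A) (e : Expr A) : Cmd A := .write r (.const 0) e

/-- Equality test. -/
def Expr.eqTest (e f : Expr A) : Expr A := .sub (.const 1) (.add (.sub e f) (.sub f e))

@[simp]
theorem Expr.eval_eqTest (x : Word) (s : State A) (e f : Expr A) :
    (e.eqTest f).eval x s = if e.eval x s = f.eval x s then 1 else 0 := by
  simp only [eqTest, eval]
  split_ifs <;> omega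

/-- The code of the symbol as which the value of `e` is read. -/
def Expr.norm (e : Expr A) : Expr A :=
  .cond e (.cond (.sub e (.const 1)) (.const 2) (.const 1)) (.const 0)

theorem symbolCode_codeSymbol (n : ℕ) : symbolCode (codeSymbol n) = min n 2 := by
  rcases n with _ | _ | n <;> simp [codeSymbol, symbolCode]

theorem codeSymbol_symbolCode (a : Option Bool) : codeSymbol (symbolCode a) = a := by
  rcases a with _ | _ | _ <;> rfl

@[simp]
theorem Expr.eval_norm (x : Word) (s : State A) (e : Expr A) :
    e.norm.eval x s = symbolCode (codeSymbol (e.eval x s)) := by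
  rw [symbolCode_codeSymbol]
  by_cases h₀ : e.eval x s = 0
  · simp [norm, h₀]
  · by_cases h₁ : e.eval x s - 1 = 0
    · simp [norm, h₀, h₁]
      omega
    · simp [norm, h₀, h₁]
      omega

/-- Execution of the command whose position in the list is the value of the variable `r`, counted
from `k`; if the list is too short, `dead` is executed. -/
def Cmd.select (r : A) (dead : Cmd A) : List (Cmd A) → ℕ → Cmd A
  | [], _ => dead
  | c :: l, k => .ite ((Expr.var r).eqTest (.const k)) c (select r dead l (k + 1))

variable [Fintype A]

theorem Exec.select {O : Oracle} {x : Word} {d n k i : ℕ} {s s' : State A} {r : A} {dead : Cmd A}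
    {l : List (Cmd A)} (hi : s.mem r 0 = k + i) (h : Exec O x d (l[i]?.getD dead) s n s') :
    Exec O x d (.select r dead l k) s (n + (Cmd.select r dead l k).cost) s' := by
  induction l generalizing k i with
  | nil => exact h.mono (Nat.le_add_right _ _)
  | cons c l ih =>
    rcases i with _ | i
    · exact (Exec.ite_true (by simp [hi]) h).mono (by simp only [Cmd.select, Cmd.cost]; omega)
    · refine (Exec.ite_false (by simp [hi]) (ih (k := k + 1) (by omega) h)).mono ?_
      simp only [Cmd.select, Cmd.cost]
      omega

theorem Cmd.cost_getD_le_cost_select (r : A) (dead : Cmd A) (l : List (Cmd A)) (i k : ℕ) :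
    (l[i]?.getD dead).cost ≤ (select r dead l k).cost := by
  induction l generalizing i k with
  | nil => simp [select]
  | cons c l ih =>
    rcases i with _ | i
    · simp [select, cost]
      omega
    · have := ih i (k + 1)
      simp [select, cost]
      omega

end

/-! ### Simulation of the instructions of a machine -/

/-- The sum of the numbers in an instruction. -/
def Instr.numerals : Instr → ℕ
  | .const i n => i + n
  | .add i j k => i + j + k
  | .sub i j k => i + j + k
  | .half i j => i + j
  | .load i j => i + j
  | .store i j => i + j
  | .jump l => l
  | .jumpZero i l => i + l
  | .input i j => i + j
  | .ask i j => i + j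
  | .query => 0
  | .answer i => i
  | .print i => i
  | .output => 0

/-- All numbers involved in the execution of the instruction `I` in the configuration `c` have at
most `m` digits. -/
structure SmallStep (O : Oracle) (x : Word) (m : ℕ) (I : Instr) (c : Config) : Prop where
  numerals : I.numerals.size ≤ m
  reg : ∀ i, (c.reg i).size ≤ m
  reg_exec : ∀ i, ((I.exec O x c).reg i).size ≤ m
  pc_exec : (I.exec O x c).pc.size ≤ m
  pc_succ : (c.pc + 1).size ≤ m

/-- How the parts of a simulated machine are accessed by a structured program. The commands `put`,
`ask` and `print` find the address of a register and the new content in the variables `address` and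
`value`. -/
structure Iface (A : Type) where
  address : A
  value : A
  /-- the variable that holds the program counter -/
  pc : A
  /-- the variable that holds the content of the answer register -/
  ans : A
  /-- content of the work register whose address is the value of an expression -/
  get : Expr A → Expr A
  /-- content of the input cell whose address is the value of an expression -/
  inp : Expr A → Expr A
  /-- write into a work register -/
  put : Cmd A
  /-- write into a query register -/
  ask : Cmd A
  print : Cmd A
  query : Cmd A
  output : Cmd A

namespace Iface

variable {A : Type}

/-- Move on to the next instruction. -/
def next (J : Iface A) : Cmd A :=
  .assign J.pc (.add (.var J.pc) (.const 1))

/-- Execute `c` with the values of `e` and `f` as address and value, and move on to the next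
instruction. -/
def block (J : Iface A) (e f : Expr A) (c : Cmd A) : Cmd A :=
  .seq (.assign J.address e) <| .seq (.assign J.value f) <| .seq c J.next

/-- Simulation of an instruction. -/
def instr (J : Iface A) : Instr → Cmd A
  | .const i n => J.block (.const i) (.const n) J.put
  | .add i j k => J.block (.const i) (.add (J.get (.const j)) (J.get (.const k))) J.put
  | .sub i j k => J.block (.const i) (.sub (J.get (.const j)) (J.get (.const k))) J.put
  | .half i j => J.block (.const i) (.half (J.get (.const j))) J.put
  | .load i j => J.block (.const i) (J.get (J.get (.const j))) J.put
  | .store i j => J.block (J.get (.const i)) (J.get (.const j)) J.put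
  | .jump l => .assign J.pc (.const l)
  | .jumpZero i l => .ite (J.get (.const i)) J.next (.assign J.pc (.const l))
  | .input i j => J.block (.const i) (J.inp (J.get (.const j))) J.put
  | .ask i j => J.block (J.get (.const i)) (J.get (.const j)) J.ask
  | .query => .seq J.query J.next
  | .answer i => J.block (.const i) (.var J.ans) J.put
  | .print i => J.block (.const 0) (J.get (.const i)) J.print
  | .output => .seq J.next J.output

/-- Simulation of one step of the program `P`; when it has halted, `dead` is executed. -/
def stepCmd (J : Iface A) (P : Program) (dead : Cmd A) : Cmd A :=
  .select J.pc dead (P.map J.instr) 0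

variable [Fintype A] [DecidableEq A]

/-- With oracle `O` on input `x`, the interface accesses a machine on input `xv` with oracle `OV`
whose configurations are represented in the way described by `Rep`. Here `m` bounds the number of
digits, `N` the time for a query, and `GoodPrint` and `GoodQuery` may restrict the configurations
in which something is printed or asked. -/
structure Sound (J : Iface A) (O : Oracle) (x : Word) (d m : ℕ) (OV : Oracle) (xv : Word)
    (Rep : State A → Config → Prop) (GoodPrint GoodQuery : Config → Prop) (N : ℕ) : Prop where
  address_ne_value : J.address ≠ J.value
  get {s c} (e : Expr A) : Rep s c → (J.get e).eval x s = c.reg (e.eval x s)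
  inp {s c} (e : Expr A) : Rep s c → (J.inp e).eval x s = symbolCode xv[e.eval x s]?
  ans {s c} : Rep s c → s.mem J.ans 0 = c.ans
  pc {s c} : Rep s c → s.mem J.pc 0 = c.pc
  set_address {s c v} : Rep s c → v.size ≤ m → Rep (s.set J.address 0 v) c
  set_value {s c v} : Rep s c → v.size ≤ m → Rep (s.set J.value 0 v) c
  set_pc {s c v} : Rep s c → v.size ≤ m → Rep (s.set J.pc 0 v) { c with pc := v }
  put {s c} : Rep s c → (s.mem J.value 0).size ≤ m → ∃ s', Exec O x d J.put s J.put.cost s' ∧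
    Rep s' { c with reg := Function.update c.reg (s.mem J.address 0) (s.mem J.value 0) }
  ask {s c} : Rep s c → ∃ s', Exec O x d J.ask s J.ask.cost s' ∧
    Rep s' { c with
      qreg := Function.update c.qreg (s.mem J.address 0) (codeSymbol (s.mem J.value 0)) }
  print {s c} : Rep s c → GoodPrint c → ∃ s', Exec O x d J.print s J.print.cost s' ∧
    Rep s' { c with out := c.out ++ (codeSymbol (s.mem J.value 0)).toList }
  query {s c} : Rep s c → GoodQuery c → ∃ s', Exec O x d J.query s N s' ∧
    Rep s' { c with
      ans := OV c.queryWord (c.asked c.queryWord)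
      asked := Function.update c.asked c.queryWord (c.asked c.queryWord + 1) }

end Iface

theorem size_le_self (n : ℕ) : n.size ≤ n :=
  Nat.size_le.2 Nat.lt_two_pow_self

theorem size_le_of_le {a b m : ℕ} (h : a ≤ b) (hb : b.size ≤ m) : a.size ≤ m :=
  (Nat.size_le_size h).trans hb

namespace Iface.Sound

variable {A : Type} [Fintype A] [DecidableEq A] {J : Iface A} {O : Oracle} {x : Word} {d m : ℕ}
  {OV : Oracle} {xv : Word} {Rep : State A → Config → Prop} {GoodPrint GoodQuery : Config → Prop}
  {N : ℕ} {s : State A} {c : Config}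

theorem next (hJ : J.Sound O x d m OV xv Rep GoodPrint GoodQuery N) (hc : Rep s c)
    (hpc : (c.pc + 1).size ≤ m) :
    ∃ s', Exec O x d J.next s J.next.cost s' ∧ Rep s' c.next :=
  ⟨_, .write rfl (by simp [hJ.pc hc]), hJ.set_pc hc hpc⟩

theorem seq_next (hJ : J.Sound O x d m OV xv Rep GoodPrint GoodQuery N) {c' : Config}
    {op : Cmd A} {n : ℕ} (hop : ∃ s', Exec O x d op s n s' ∧ Rep s' c')
    (hpc : (c'.pc + 1).size ≤ m) :
    ∃ s', Exec O x d (.seq op J.next) s (n + J.next.cost) s' ∧ Rep s' c'.next := by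
  obtain ⟨s₁, hexec, hs₁⟩ := hop
  obtain ⟨s₂, hnext, hs₂⟩ := hJ.next hs₁ hpc
  exact ⟨s₂, hexec.seq hnext, hs₂⟩

/-- `f` is evaluated when the address has already been stored, hence the form of the second
hypothesis. -/
theorem block (hJ : J.Sound O x d m OV xv Rep GoodPrint GoodQuery N) {c' : Config} {e f : Expr A}
    {op : Cmd A} {i v : ℕ} (hc : Rep s c) (he : e.eval x s = i)
    (hf : ∀ s, Rep s c → f.eval x s = v) (hi : i.size ≤ m) (hv : v.size ≤ m)
    (hop : ∀ s, Rep s c → s.mem J.address 0 = i → s.mem J.value 0 = v →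
      ∃ s', Exec O x d op s op.cost s' ∧ Rep s' c')
    (hpc : (c'.pc + 1).size ≤ m) :
    ∃ s', Exec O x d (J.block e f op) s (J.block e f op).cost s' ∧ Rep s' c'.next := by
  have haddr := hJ.set_address hc hi
  obtain ⟨s', hexec, hs'⟩ := hJ.seq_next (hop _ (hJ.set_value haddr hv)
    (by simp [hJ.address_ne_value]) (by simp)) hpc
  exact ⟨s', (Exec.write rfl he).seq ((Exec.write rfl (hf _ haddr)).seq hexec), hs'⟩

theorem block_put (hJ : J.Sound O x d m OV xv Rep GoodPrint GoodQuery N) {e f : Expr A}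
    {i v : ℕ} (hc : Rep s c) (he : e.eval x s = i) (hf : ∀ s, Rep s c → f.eval x s = v)
    (hi : i.size ≤ m) (hv : v.size ≤ m) (hpc : (c.pc + 1).size ≤ m) :
    ∃ s', Exec O x d (J.block e f J.put) s (J.block e f J.put).cost s' ∧ Rep s' (c.set i v) :=
  hJ.block (c' := { c with reg := Function.update c.reg i v }) hc he hf hi hv
    (fun _ hs hi' hv' => by simpa only [hi', hv'] using hJ.put hs (hv' ▸ hv)) hpc

theorem instr_jumpZero (hJ : J.Sound O x d m OV xv Rep GoodPrint GoodQuery N) {i l : ℕ}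
    (hc : Rep s c) (hI : SmallStep OV xv m (.jumpZero i l) c) :
    ∃ s', Exec O x d (J.instr (.jumpZero i l)) s (J.instr (.jumpZero i l)).cost s' ∧
      Rep s' ((Instr.jumpZero i l).exec OV xv c) := by
  have hget : (J.get (.const i)).eval x s = c.reg i := hJ.get _ hc
  have hpc := hI.pc_exec
  simp only [Instr.exec] at hpc ⊢
  split_ifs at hpc ⊢ with h0
  · refine ⟨_, (Exec.ite_false (hget.trans h0) (Exec.write rfl rfl)).mono ?_, hJ.set_pc hc hpc⟩
    simp only [Iface.instr, Cmd.cost]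
    omega
  · obtain ⟨s', hexec, hs'⟩ := hJ.next hc hpc
    refine ⟨s', (Exec.ite_true (by rwa [hget]) hexec).mono ?_, hs'⟩
    simp only [Iface.instr, Cmd.cost]
    omega

theorem instr_query (hJ : J.Sound O x d m OV xv Rep GoodPrint GoodQuery N) (hc : Rep s c)
    (hgood : GoodQuery c) (hpc : (c.pc + 1).size ≤ m) :
    ∃ s', Exec O x d (J.instr .query) s (N + J.next.cost) s' ∧ Rep s' (Instr.query.exec OV xv c) :=
  hJ.seq_next (hJ.query hc hgood) hpc

theorem instr (hJ : J.Sound O x d m OV xv Rep GoodPrint GoodQuery N) {I : Instr} (hc : Rep s c)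
    (hI : SmallStep OV xv m I c) (hquery : I ≠ .query) (houtput : I ≠ .output)
    (hprint : GoodPrint c) :
    ∃ s', Exec O x d (J.instr I) s (J.instr I).cost s' ∧ Rep s' (I.exec OV xv c) := by
  have hget : ∀ j s, Rep s c → (J.get (.const j)).eval x s = c.reg j := fun j s h => hJ.get _ h
  have hle : ∀ {j}, j ≤ I.numerals → j.size ≤ m := fun h => size_le_of_le h hI.numerals
  have hnew := hI.reg_exec
  cases I with
  | jump l => exact ⟨_, Exec.write rfl rfl, hJ.set_pc hc hI.pc_exec⟩
  | jumpZero i l => exact hJ.instr_jumpZero hc hI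
  | query => exact absurd rfl hquery
  | output => exact absurd rfl houtput
  | ask i j =>
    exact hJ.block (c' := { c with
        qreg := Function.update c.qreg (c.reg i) (codeSymbol (c.reg j)) })
      hc (hget i s hc) (hget j) (hI.reg _) (hI.reg _)
      (fun _ hs hi hv => by simpa only [hi, hv] using hJ.ask hs) hI.pc_succ
  | print i =>
    exact hJ.block (c' := { c with out := c.out ++ (codeSymbol (c.reg i)).toList })
      hc rfl (hget i) (by simp) (hI.reg _)
      (fun _ hs _ hv => by simpa only [hv] using hJ.print hs hprint) hI.pc_succ
  | store i j =>
    exact hJ.block_put hc (hget i s hc) (hget j) (hI.reg _) (hI.reg _) hI.pc_succ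
  | const i n | add i j k | sub i j k | half i j | load i j | input i j | answer i =>
    refine hJ.block_put hc rfl (fun s hs => ?_) (hle (by simp only [Instr.numerals]; omega))
      (by simpa [Instr.exec, Config.set] using hnew i) hI.pc_succ
    simp only [Expr.eval, hJ.get _ hs, hJ.inp _ hs, hJ.ans hs]

theorem stepCmd (hJ : J.Sound O x d m OV xv Rep GoodPrint GoodQuery N) {s' : State A}
    {P : Program} {I : Instr} {dead : Cmd A} {n : ℕ} (hc : Rep s c) (hP : P[c.pc]? = some I)
    (h : Exec O x d (J.instr I) s ((J.instr I).cost + n) s') :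
    Exec O x d (J.stepCmd P dead) s (2 * (J.stepCmd P dead).cost + n) s' := by
  have hcmd : (P.map J.instr)[c.pc]?.getD dead = J.instr I := by simp [hP]
  have hcost := Cmd.cost_getD_le_cost_select J.pc dead (P.map J.instr) c.pc 0
  rw [← hcmd] at h
  refine (Exec.select (k := 0) (by rw [hJ.pc hc, zero_add]) h).mono ?_
  rw [hcmd] at hcost ⊢
  rw [Iface.stepCmd]
  omega

theorem stepCmd_dead (hJ : J.Sound O x d m OV xv Rep GoodPrint GoodQuery N) {s' : State A}
    {P : Program} {dead : Cmd A} (hc : Rep s c) (hP : P[c.pc]? = none)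
    (h : Exec O x d dead s dead.cost s') :
    Exec O x d (J.stepCmd P dead) s (2 * (J.stepCmd P dead).cost) s' := by
  have hcmd : (P.map J.instr)[c.pc]?.getD dead = dead := by simp [hP]
  have hcost := Cmd.cost_getD_le_cost_select J.pc dead (P.map J.instr) c.pc 0
  nth_rewrite 1 [← hcmd] at h
  refine (Exec.select (k := 0) (by rw [hJ.pc hc, zero_add]) h).mono ?_
  rw [hcmd] at hcost
  rw [Iface.stepCmd]
  omega

end Iface.Sound

/-! ### Runs -/

theorem Instr.pc_exec_le {O : Oracle} {x : Word} (I : Instr) (c : Config) :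
    (I.exec O x c).pc ≤ max (c.pc + 1) I.numerals := by
  cases I <;> simp [Instr.exec, Config.set, Config.next, Instr.numerals]
  split_ifs <;> simp

theorem Instr.length_out_exec_le {O : Oracle} {x : Word} (I : Instr) (c : Config) :
    (I.exec O x c).out.length ≤ c.out.length + 1 := by
  cases I with
  | print i =>
    simp only [Instr.exec, List.length_append, Option.length_toList]
    split <;> simp
  | jumpZero i l =>
    simp only [Instr.exec]
    split_ifs <;> simp [Config.next]
  | _ => simp [Instr.exec, Config.set, Config.next]

theorem Instr.asked_exec_le {O : Oracle} {x : Word} (I : Instr) (c : Config) (w : Word) :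
    (I.exec O x c).asked w ≤ c.asked w + 1 := by
  cases I with
  | query =>
    simp only [Instr.exec, Function.update_apply]
    split_ifs with h
    · rw [h]
    · exact Nat.le_succ _
  | jumpZero i l =>
    simp only [Instr.exec]
    split_ifs <;> simp [Config.next]
  | _ => exact Nat.le_succ _

theorem Instr.qreg_exec {O : Oracle} {x : Word} (I : Instr) (c : Config) :
    ∃ i, ∀ k ≠ i, (I.exec O x c).qreg k = c.qreg k := by
  cases I with
  | ask i j => exact ⟨c.reg i, fun k hk => Function.update_of_ne hk _ _⟩
  | jumpZero i l =>
    refine ⟨0, fun k _ => ?_⟩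
    simp only [Instr.exec]
    split_ifs <;> rfl
  | _ => exact ⟨0, fun k _ => rfl⟩

/-- A bound for the program counter and for the numbers in the program. -/
def Program.bound (M : Program) : ℕ := M.length + (M.map Instr.numerals).sum

section
variable {M : Program} {O : Oracle} {x : Word} {t d m : ℕ} {I : Instr}

theorem run_succ : run M O x (t + 1) = step M O x (run M O x t) :=
  Function.iterate_succ_apply' ..

theorem run_succ_of_getElem? (h : M[(run M O x t).pc]? = some I) :
    run M O x (t + 1) = I.exec O x (run M O x t) := by
  rw [run_succ, step, h]

/-- The induction principle for properties of runs: the number of steps matters only as a bound. -/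
theorem run_induction {P : ℕ → Config → Prop} (hzero : P 0 startConfig)
    (hmono : ∀ t c, P t c → P (t + 1) c)
    (hexec : ∀ t c (I : Instr), P t c → P (t + 1) (I.exec O x c)) (t : ℕ) : P t (run M O x t) := by
  induction t with
  | zero => exact hzero
  | succ t ih =>
    rw [run_succ, step]
    split
    · exact hmono _ _ ih
    · exact hexec _ _ _ ih

theorem HaltedAt.run_eq (h : HaltedAt M O x t) {t' : ℕ} (ht : t ≤ t') :
    run M O x t' = run M O x t := by
  induction t', ht using Nat.le_induction with
  | base => rfl
  | succ n _ ih => rw [run_succ, ih, step, show M[(run M O x t).pc]? = none from h]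

theorem HaltedAt.mono (h : HaltedAt M O x t) {t' : ℕ} (ht : t ≤ t') : HaltedAt M O x t' := by
  rw [HaltedAt, h.run_eq ht]
  exact h

theorem numerals_le_bound (h : I ∈ M) : I.numerals ≤ Program.bound M :=
  (List.single_le_sum (by simp) _ (List.mem_map_of_mem h)).trans (Nat.le_add_left ..)

theorem succ_pc_le_bound (h : M[(run M O x t).pc]? = some I) :
    (run M O x t).pc + 1 ≤ Program.bound M :=
  (List.getElem?_eq_some_iff.1 h).1.trans_le (Nat.le_add_right ..)

theorem pc_le_bound : (run M O x t).pc ≤ Program.bound M := by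
  induction t with
  | zero => exact Nat.zero_le _
  | succ t ih =>
    rcases h : M[(run M O x t).pc]? with _ | I
    · rwa [run_succ, step, h]
    · rw [run_succ_of_getElem? h]
      exact (I.pc_exec_le _).trans
        (max_le (succ_pc_le_bound h) (numerals_le_bound (List.mem_of_getElem? h)))

theorem RegistersBounded.smallStep (h : RegistersBounded M O x d) (hd : d ≤ m)
    (hM : (Program.bound M).size ≤ m) (hI : M[(run M O x t).pc]? = some I) :
    SmallStep O x m I (run M O x t) where
  numerals := size_le_of_le (numerals_le_bound (List.mem_of_getElem? hI)) hM
  reg i := ((h t).1 i).trans hd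
  reg_exec i := by
    rw [← run_succ_of_getElem? hI]
    exact ((h (t + 1)).1 i).trans hd
  pc_exec := by
    rw [← run_succ_of_getElem? hI]
    exact size_le_of_le pc_le_bound hM
  pc_succ := size_le_of_le (succ_pc_le_bound hI) hM

theorem length_out_add_le (s : ℕ) :
    (run M O x (t + s)).out.length ≤ (run M O x t).out.length + s := by
  induction s with
  | zero => exact le_rfl
  | succ s ih =>
    rw [← add_assoc t, run_succ, step]
    split
    · exact ih.trans (Nat.le_succ _)
    · exact (Instr.length_out_exec_le _ _).trans (Nat.succ_le_succ ih)

theorem length_out_le : (run M O x t).out.length ≤ t := by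
  simpa [run, startConfig] using length_out_add_le (M := M) (O := O) (x := x) (t := 0) t

theorem asked_le (w : Word) : (run M O x t).asked w ≤ t :=
  run_induction (P := fun t c => c.asked w ≤ t) le_rfl (fun _ _ h => h.trans (Nat.le_succ _))
    (fun _ c I h => (I.asked_exec_le c w).trans (Nat.succ_le_succ h)) t

theorem exists_support_qreg :
    ∃ S : Finset ℕ, S.card ≤ t ∧ ∀ i ∉ S, (run M O x t).qreg i = none := by
  refine run_induction (P := fun t c => ∃ S : Finset ℕ, S.card ≤ t ∧ ∀ i ∉ S, c.qreg i = none)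
    ⟨∅, le_rfl, fun _ _ => rfl⟩ (fun t c ⟨S, hS, h⟩ => ⟨S, hS.trans (Nat.le_succ t), h⟩)
    (fun t c I ⟨S, hS, h⟩ => ?_) t
  obtain ⟨i, hi⟩ := I.qreg_exec c
  refine ⟨insert i S, (Finset.card_insert_le _ _).trans (Nat.succ_le_succ hS), fun k hk => ?_⟩
  rw [Finset.mem_insert, not_or] at hk
  rw [hi k hk.1, h k hk.2]

theorem exists_qreg_eq_none : ∃ i ≤ t, (run M O x t).qreg i = none := by
  obtain ⟨S, hS, h⟩ := exists_support_qreg (M := M) (O := O) (x := x) (t := t)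
  obtain ⟨i, hi, hiS⟩ : ∃ i ∈ Finset.range (t + 1), i ∉ S :=
    Finset.exists_mem_notMem_of_card_lt_card (by rw [Finset.card_range]; omega)
  exact ⟨i, Nat.lt_succ_iff.1 (Finset.mem_range.1 hi), h i hiS⟩

end

namespace Config

theorem length_queryWord (c : Config) : c.queryWord.length = sInf {i | c.qreg i = none} := by
  simp [queryWord]

theorem length_queryWord_le {c : Config} {i : ℕ} (h : c.qreg i = none) :
    c.queryWord.length ≤ i :=
  c.length_queryWord.trans_le (Nat.sInf_le h)

theorem qreg_eq_getElem?_queryWord {c : Config} (h : ∃ i, c.qreg i = none) {i : ℕ}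
    (hi : i ≤ c.queryWord.length) : c.qreg i = c.queryWord[i]? := by
  rcases hi.eq_or_lt with rfl | hi
  · rw [List.getElem?_eq_none le_rfl, length_queryWord]
    exact Nat.sInf_mem (s := {i | c.qreg i = none}) h
  · have hne : c.qreg i ≠ none :=
      Nat.notMem_of_lt_sInf (s := {i | c.qreg i = none}) (c.length_queryWord ▸ hi)
    obtain ⟨b, hb⟩ := Option.ne_none_iff_exists'.1 hne
    rw [List.getElem?_eq_getElem hi]
    simp [queryWord, hb]

theorem queryWord_eq {c : Config} {w : Word} (h : ∀ i ≤ w.length, c.qreg i = w[i]?) :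
    c.queryWord = w := by
  have hnone : c.qreg w.length = none := by simpa using h _ le_rfl
  have hlength : c.queryWord.length = w.length := by
    refine (length_queryWord_le hnone).antisymm ?_
    by_contra! hlt
    have := h _ hlt.le
    rw [qreg_eq_getElem?_queryWord ⟨_, hnone⟩ le_rfl, List.getElem?_eq_none le_rfl,
      List.getElem?_eq_getElem hlt] at this
    simp at this
  refine List.ext_getElem? fun i => ?_
  rcases le_or_gt i w.length with hi | hi
  · rw [← qreg_eq_getElem?_queryWord ⟨_, hnone⟩ (hlength ▸ hi), h i hi]
  · rw [List.getElem?_eq_none (by omega), List.getElem?_eq_none hi.le]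

end Config

theorem length_queryWord_run_le {M : Program} {O : Oracle} {x : Word} {t : ℕ} :
    (run M O x t).queryWord.length ≤ t := by
  obtain ⟨i, hi, h⟩ := exists_qreg_eq_none (M := M) (O := O) (x := x) (t := t)
  exact (Config.length_queryWord_le h).trans hi

/-! ### Codes of words -/

theorem wordCode_cons (b : Bool) (w : Word) : wordCode (b :: w) = 2 * wordCode w + b.toNat := rfl

theorem wordCode_pos (w : Word) : 0 < wordCode w := by
  induction w with
  | nil => exact Nat.one_pos
  | cons b w ih => rw [wordCode_cons]; omega

theorem wordCode_lt (w : Word) : wordCode w < 2 ^ (w.length + 1) := by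
  induction w with
  | nil => simp [wordCode]
  | cons b w ih =>
    have := b.toNat_lt
    rw [wordCode_cons, List.length_cons, pow_succ]
    omega

theorem wordCode_injective : Function.Injective wordCode := by
  intro w
  induction w with
  | nil =>
    rintro (_ | ⟨b', w'⟩) h
    · rfl
    · have := wordCode_pos w'
      rw [wordCode_cons, wordCode, List.foldr_nil] at h
      omega
  | cons b w ih =>
    rintro (_ | ⟨b', w'⟩) h
    · have := wordCode_pos w
      rw [wordCode_cons, wordCode.eq_def [], List.foldr_nil] at h
      omega
    · have hb := b.toNat_lt
      have hb' := b'.toNat_lt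
      rw [wordCode_cons, wordCode_cons] at h
      obtain rfl : w = w' := ih (by omega)
      cases b <;> cases b' <;> simp_all

/-- The code of the reversed word, which can be computed while the word is read. -/
def revCode (w : Word) : ℕ := wordCode w.reverse

theorem revCode_concat (w : Word) (b : Bool) : revCode (w ++ [b]) = 2 * revCode w + b.toNat := by
  rw [revCode, List.reverse_concat, wordCode_cons, revCode]

theorem revCode_lt (w : Word) : revCode w < 2 ^ (w.length + 1) := by
  simpa [revCode] using wordCode_lt w.reverse

theorem revCode_injective : Function.Injective revCode :=
  wordCode_injective.comp List.reverse_injective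

/-- The cache address of the answer to the word `w` when it has been asked `j` times before. The
cache address for the next asking is twice this number. -/
def cacheAddr (w : Word) (j : ℕ) : ℕ := (2 * revCode w + 1) * 2 ^ j

theorem cacheAddr_pos (w : Word) (j : ℕ) : 0 < cacheAddr w j := by
  unfold cacheAddr
  positivity

theorem cacheAddr_succ (w : Word) (j : ℕ) :
    cacheAddr w (j + 1) = cacheAddr w j + cacheAddr w j := by
  unfold cacheAddr
  ring

theorem odd_mul_two_pow_inj {a b i j : ℕ} (h : (2 * a + 1) * 2 ^ i = (2 * b + 1) * 2 ^ j) :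
    a = b ∧ i = j := by
  induction i generalizing j with
  | zero =>
    rcases j with _ | j
    · omega
    · rw [pow_succ, ← mul_assoc] at h
      omega
  | succ i ih =>
    rcases j with _ | j
    · rw [pow_succ, ← mul_assoc] at h
      omega
    · have := ih (j := j) (by simp only [pow_succ] at h; linarith)
      omega

theorem cacheAddr_inj {w w' : Word} {j j' : ℕ} :
    cacheAddr w j = cacheAddr w' j' ↔ w = w' ∧ j = j' := by
  refine ⟨fun h => ?_, by rintro ⟨rfl, rfl⟩; rfl⟩
  obtain ⟨hcode, hj⟩ := odd_mul_two_pow_inj h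
  exact ⟨revCode_injective hcode, hj⟩

theorem size_cacheAddr_le (w : Word) (j : ℕ) : (cacheAddr w j).size ≤ w.length + 2 + j := by
  have := revCode_lt w
  rw [Nat.size_le, cacheAddr, pow_add, pow_succ]
  exact Nat.mul_lt_mul_of_pos_right (by omega) (by positivity)

/-! ### The memory of the simulator -/

/-- The arrays that represent the simulated enumerator, together with the flags that tell that it
has halted or that it is about to output a word. -/
inductive MainArr where
  | pc
  | ans
  | reg
  | halted
  | emit
  deriving DecidableEq

instance : Fintype MainArr where
  elems := {.pc, .ans, .reg, .halted, .emit}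
  complete a := by cases a <;> decide

/-- The scalar variables of the subroutine that is running. -/
inductive SubArr where
  | pc
  | ans
  | running
  deriving DecidableEq

instance : Fintype SubArr where
  elems := {.pc, .ans, .running}
  complete a := by cases a <;> decide

/-- The arrays that have to be cleared before a subroutine starts. -/
inductive Volatile where
  | reg
  | qreg
  /-- the cache address for the next query of each word -/
  | next
  deriving DecidableEq

instance : Fintype Volatile where
  elems := {.reg, .qreg, .next}
  complete a := by cases a <;> decide

/-- The arrays for words: the query registers of the enumerator, the image of the query under the
reduction, and whatever is printed by the decision procedure. -/
inductive Tape where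
  | query
  | image
  | dump
  deriving DecidableEq

instance : Fintype Tape where
  elems := {.query, .image, .dump}
  complete a := by cases a <;> decide

/-- Variables for intermediate results. -/
inductive Scratch where
  | address
  | value
  | code
  | pos
  | slot
  deriving DecidableEq

instance : Fintype Scratch where
  elems := {.address, .value, .code, .pos, .slot}
  complete a := by cases a <;> decide

/-- The arrays of the simulator. -/
inductive Arr where
  | main (a : MainArr)
  | sub (a : SubArr)
  | entries (k : Volatile)
  /-- the epochs in which the entries of a volatile array were written -/
  | stamp (k : Volatile)
  | epoch
  | tape (t : Tape)
  | length (t : Tape)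
  /-- the answers that were given by the oracle so far, increased by `1` -/
  | cache
  | scratch (a : Scratch)
  deriving DecidableEq, Fintype

/-- An entry of a volatile array. Entries with an old stamp count as `0`, so the array is cleared by
beginning a new epoch. -/
def State.stamped (s : State Arr) (k : Volatile) (i : ℕ) : ℕ :=
  if s.mem (.stamp k) i = s.mem .epoch 0 then s.mem (.entries k) i else 0

/-- An entry of a volatile array, as an expression. -/
def Expr.stamped (k : Volatile) (e : Expr Arr) : Expr Arr :=
  .cond (.eqTest (.mem (.stamp k) e) (.var .epoch)) (.mem (.entries k) e) (.const 0)

@[simp]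
theorem Expr.eval_stamped (x : Word) (s : State Arr) (k : Volatile) (e : Expr Arr) :
    (Expr.stamped k e).eval x s = s.stamped k (e.eval x s) := by
  by_cases h : s.mem (.stamp k) (e.eval x s) = s.mem .epoch 0 <;>
    simp [Expr.stamped, State.stamped, h]

theorem State.mem_set_self {A : Type} [DecidableEq A] (s : State A) (r : A) (i v : ℕ) :
    (s.set r i v).mem r = Function.update (s.mem r) i v := by
  simp [State.set]

/-- Assignment to an entry of a volatile array. -/
def State.setStamped (s : State Arr) (k : Volatile) (i v : ℕ) : State Arr :=
  (s.set (.entries k) i v).set (.stamp k) i (s.mem .epoch 0)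

theorem State.stamped_setStamped (s : State Arr) (k : Volatile) (i v : ℕ) :
    (s.setStamped k i v).stamped k = Function.update (s.stamped k) i v := by
  funext j
  by_cases hj : j = i <;> simp [State.stamped, State.setStamped, hj]

/-- Assignment to an entry of a volatile array; the index is the value of the variable `a`. -/
def Cmd.writeStamped (k : Volatile) (a : Scratch) (f : Expr Arr) : Cmd Arr :=
  .seq (.write (.entries k) (.var (.scratch a)) f)
    (.write (.stamp k) (.var (.scratch a)) (.var .epoch))

theorem Exec.writeStamped {O : Oracle} {x : Word} {d : ℕ} {s : State Arr} {k : Volatile}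
    {a : Scratch} {f : Expr Arr} {i v : ℕ} (hi : s.mem (.scratch a) 0 = i)
    (hf : f.eval x s = v) :
    Exec O x d (.writeStamped k a f) s (Cmd.writeStamped k a f).cost (s.setStamped k i v) :=
  (Exec.write (by simpa using hi) hf).seq (Exec.write (by simpa using hi) rfl)

/-- The word `w` is stored on the tape `t`. -/
structure State.Holds (s : State Arr) (t : Tape) (w : Word) : Prop where
  length : s.mem (.length t) 0 = w.length
  symbol : ∀ i < w.length, s.mem (.tape t) i = symbolCode w[i]?

theorem State.holds_nil (s : State Arr) (t : Tape) : (s.set (.length t) 0 0).Holds t [] :=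
  ⟨by simp, by simp⟩

theorem State.Holds.concat {s : State Arr} {t : Tape} {w : Word} (h : s.Holds t w) (a : Bool) :
    ((s.set (.tape t) w.length (symbolCode (some a))).set (.length t) 0 (w.length + 1)).Holds t
      (w ++ [a]) where
  length := by simp
  symbol i hi := by
    rw [List.length_append, List.length_singleton, Nat.lt_succ_iff_lt_or_eq] at hi
    rcases hi with hi | rfl
    · simp [hi.ne, h.symbol i hi, List.getElem?_append_left hi]
    · simp

/-- The arrays represent the configuration `c` of the enumerator. -/
structure MainMem (c : Config) (s : State Arr) : Prop where
  pc : s.mem (.main .pc) 0 = c.pc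
  ans : s.mem (.main .ans) 0 = c.ans
  reg : s.mem (.main .reg) = c.reg
  qreg : s.mem (.tape .query) = symbolCode ∘ c.qreg
  out : s.out = c.out
  halted : s.mem (.main .halted) 0 = 0
  emit : s.mem (.main .emit) 0 = 0

/-- The part of the memory that outlives the subroutines is consistent: the cache contains the
answers given so far, no stamp lies in the future, and all numbers have at most `m` digits. -/
structure Tidy (O : Oracle) (m : ℕ) (s : State Arr) : Prop where
  cache : ∀ w j, s.mem .cache (cacheAddr w j) = if j < s.asked w then O w j + 1 else 0
  stamp_le : ∀ k i, s.mem (.stamp k) i ≤ s.mem .epoch 0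
  size : ∀ r i, (s.mem r i).size ≤ m
  size_ans : s.ans.size ≤ m

theorem State.size_set {A : Type} [DecidableEq A] {s : State A} {m v : ℕ}
    (h : ∀ r i, (s.mem r i).size ≤ m) (hv : v.size ≤ m) (r : A) (i : ℕ) (r' : A) (i' : ℕ) :
    ((s.set r i v).mem r' i').size ≤ m := by
  rw [State.mem_set]
  split_ifs
  exacts [hv, h r' i']

section
variable {O : Oracle} {m : ℕ} {s : State Arr}

theorem Tidy.set (h : Tidy O m s) {r : Arr} {i v : ℕ} (hv : v.size ≤ m)
    (hcache : r ≠ .cache := by simp) (hepoch : r ≠ .epoch := by simp)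
    (hstamp : ∀ k, r = .stamp k → v ≤ s.mem .epoch 0 := by simp) : Tidy O m (s.set r i v) where
  cache w j := by
    rw [State.mem_set, if_neg fun hr => hcache hr.1.symm]
    exact h.cache w j
  stamp_le k j := by
    simp only [State.mem_set, hepoch.symm, false_and, if_false]
    split_ifs with hr
    exacts [hstamp k hr.1.symm, h.stamp_le k j]
  size := State.size_set h.size hv r i
  size_ans := h.size_ans

theorem Tidy.setStamped (h : Tidy O m s) {k : Volatile} {i v : ℕ} (hv : v.size ≤ m) :
    Tidy O m (s.setStamped k i v) :=
  (h.set hv).set (h.size _ _) (by simp) (by simp) (by simp)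

end

/-! ### Simulation of a subroutine -/

/-- The two subroutines that answer a query: the reduction computes the image of the query, and the
decision procedure with oracle decides the image. -/
inductive Stage where
  | reduction
  | decision

/-- The tape with the input of a subroutine. -/
def Stage.input : Stage → Tape
  | reduction => .query
  | decision => .image

/-- The tape for the word that is printed by a subroutine. -/
def Stage.output : Stage → Tape
  | reduction => .image
  | decision => .dump

/-- The memory represents the configuration `c` of a subroutine that is run on input `w` in epoch
`e`, while the enumerator is in the configuration `cM`. -/
structure SubRep (O : Oracle) (m e : ℕ) (cM : Config) (st : Stage) (w : Word) (s : State Arr)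
    (c : Config) : Prop where
  main : MainMem cM s
  tidy : Tidy O m s
  epoch : s.mem .epoch 0 = e
  running : s.mem (.sub .running) 0 = 1
  reg : s.stamped .reg = c.reg
  qreg : s.stamped .qreg = symbolCode ∘ c.qreg
  pc : s.mem (.sub .pc) 0 = c.pc
  ans : s.mem (.sub .ans) 0 = c.ans
  input : s.Holds st.input w
  output : s.Holds st.output c.out
  next : st = .decision → ∀ u,
    s.stamped .next (revCode u) = if c.asked u = 0 then 0 else cacheAddr u (c.asked u)
  asked_le : st = .decision → ∀ u, c.asked u ≤ s.asked u

theorem size_symbolCode_le {m : ℕ} (h : 2 ≤ m) (a : Option Bool) : (symbolCode a).size ≤ m := by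
  refine size_le_of_le (b := 2) ?_ (le_trans (by simp [Nat.size_le]) h)
  rcases a with _ | _ | _ <;> simp [symbolCode]

namespace SubRep

variable {O : Oracle} {m e : ℕ} {cM : Config} {st : Stage} {w : Word} {s : State Arr} {c : Config}

theorem set_scratch (h : SubRep O m e cM st w s c) {a : Scratch} {v : ℕ} (hv : v.size ≤ m) :
    SubRep O m e cM st w (s.set (.scratch a) 0 v) c :=
  { h with
    main := { h.main with }
    tidy := h.tidy.set hv
    input := { h.input with }
    output := { h.output with } }

theorem set_queryRegisters (h : SubRep O m e cM st w s c) (q : ℕ → Option Bool) :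
    SubRep O m e cM st w { s with qreg := q } c :=
  { h with
    main := { h.main with }
    tidy := { h.tidy with }
    input := { h.input with }
    output := { h.output with } }

theorem set_reg (h : SubRep O m e cM st w s c) {i v : ℕ} (hv : v.size ≤ m) :
    SubRep O m e cM st w (s.setStamped .reg i v) { c with reg := Function.update c.reg i v } :=
  { h with
    main := { h.main with }
    tidy := h.tidy.setStamped hv
    reg := by rw [State.stamped_setStamped, h.reg]
    input := { h.input with }
    output := { h.output with } }

theorem set_qreg (h : SubRep O m e cM st w s c) {i : ℕ} {a : Option Bool} (hm : 2 ≤ m) :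
    SubRep O m e cM st w (s.setStamped .qreg i (symbolCode a))
      { c with qreg := Function.update c.qreg i a } :=
  { h with
    main := { h.main with }
    tidy := h.tidy.setStamped (size_symbolCode_le hm a)
    qreg := by rw [State.stamped_setStamped, h.qreg, Function.comp_update]
    input := { h.input with }
    output := { h.output with } }

theorem set_pc (h : SubRep O m e cM st w s c) {v : ℕ} (hv : v.size ≤ m) :
    SubRep O m e cM st w (s.set (.sub .pc) 0 v) { c with pc := v } :=
  { h with
    main := { h.main with }
    tidy := h.tidy.set hv
    pc := by simp
    input := { h.input with }
    output := { h.output with } }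

theorem set_ans (h : SubRep O m e cM st w s c) {v : ℕ} (hv : v.size ≤ m) :
    SubRep O m e cM st w (s.set (.sub .ans) 0 v) { c with ans := v } :=
  { h with
    main := { h.main with }
    tidy := h.tidy.set hv
    ans := by simp
    input := { h.input with }
    output := { h.output with } }

theorem concat_out (h : SubRep O m e cM st w s c) {a : Bool} (hm : 2 ≤ m)
    (hlen : (c.out.length + 1).size ≤ m) :
    SubRep O m e cM st w ((s.set (.tape st.output) c.out.length (symbolCode (some a))).set
      (.length st.output) 0 (c.out.length + 1)) { c with out := c.out ++ [a] } :=
  { h with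
    main := { h.main with qreg := by cases st <;> exact h.main.qreg }
    tidy := (h.tidy.set (size_symbolCode_le hm _)).set hlen
    input := by cases st <;> exact { h.input with }
    output := h.output.concat a }

theorem clear_out (h : SubRep O m e cM st w s c) :
    SubRep O m e cM st w (s.set (.length st.output) 0 0) { c with out := [] } :=
  { h with
    main := { h.main with }
    tidy := h.tidy.set (by simp)
    input := by cases st <;> exact { h.input with }
    output := s.holds_nil _ }

end SubRep

/-- The next symbol of the query is copied. -/
def copySymbol : Cmd Arr :=
  .seq (.ask (.var (.scratch .pos)) (.stamped .qreg (.var (.scratch .pos)))) <|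
  .seq (.assign (.scratch .code) (.add (.add (.var (.scratch .code)) (.var (.scratch .code)))
    (.sub (.stamped .qreg (.var (.scratch .pos))) (.const 1)))) <|
  .assign (.scratch .pos) (.add (.var (.scratch .pos)) (.const 1))

/-- The query of the subroutine is copied to the query registers proper. -/
def copyLoop : Cmd Arr :=
  .loop (.stamped .qreg (.var (.scratch .pos))) copySymbol

/-- The query of the subroutine is copied to the query registers proper, and its code is
computed. -/
def copyQuery : Cmd Arr :=
  .seq (.assign (.scratch .pos) (.const 0)) <|
  .seq (.assign (.scratch .code) (.const 1)) <|
  .seq copyLoop <|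
  .ask (.var (.scratch .pos)) (.const 0)

/-- The cache address of the next answer is computed; a query that is asked for the first time since
the beginning of the epoch has no entry in the array `next`. -/
def locate : Cmd Arr :=
  .assign (.scratch .slot) (.cond (.stamped .next (.var (.scratch .code)))
    (.stamped .next (.var (.scratch .code)))
    (.add (.add (.var (.scratch .code)) (.var (.scratch .code))) (.const 1)))

/-- The oracle is asked, unless the answer is already in the cache. -/
def fetch : Cmd Arr :=
  .ite (.mem .cache (.var (.scratch .slot))) .skip
    (.seq .query (.write .cache (.var (.scratch .slot)) (.add .ans (.const 1))))

/-- The answer is read from the cache, and the cache address is advanced. -/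
def deliver : Cmd Arr :=
  .seq (.writeStamped .next .code (.add (.var (.scratch .slot)) (.var (.scratch .slot)))) <|
  .assign (.sub .ans) (.sub (.mem .cache (.var (.scratch .slot))) (.const 1))

/-- A query of the decision procedure. Every run of it has to get the same answers to a word, while
the oracle gives each of its answers only once; hence the cache. -/
def cachedQuery : Cmd Arr :=
  .seq copyQuery (.seq locate (.seq fetch deliver))

/-- The first `i` symbols of the query of the configuration `c` have been copied. -/
structure CopiedUpTo (c : Config) (i : ℕ) (s : State Arr) : Prop where
  pos : s.mem (.scratch .pos) 0 = i
  code : s.mem (.scratch .code) 0 = revCode (c.queryWord.take i)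
  symbol : ∀ j < i, s.qreg j = c.queryWord[j]?

/-- The length of the query of the configuration `c` and its next answer respect the bounds `d` for
the length of words and `m` for the number of digits. -/
structure AdmissibleQuery (O : Oracle) (d m : ℕ) (c : Config) : Prop where
  blank : ∃ i, c.qreg i = none
  length_le : c.queryWord.length ≤ d
  size_answer : (O c.queryWord (c.asked c.queryWord)).size ≤ d
  size_answer_succ : (O c.queryWord (c.asked c.queryWord) + 1).size ≤ m
  length_add_asked_le : c.queryWord.length + 3 + c.asked c.queryWord ≤ m

theorem revCode_take_succ {u : Word} {i : ℕ} (hi : i < u.length) :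
    revCode (u.take (i + 1)) =
      revCode (u.take i) + revCode (u.take i) + (symbolCode u[i]? - 1) := by
  rw [List.take_succ_eq_append_getElem hi, revCode_concat, List.getElem?_eq_getElem hi]
  cases u[i] <;> simp [symbolCode] <;> ring

theorem size_revCode_take_le {u : Word} {i m : ℕ} (hm : u.length < m) :
    (revCode (u.take i)).size ≤ m := by
  rw [Nat.size_le]
  refine (revCode_lt _).trans_le (Nat.pow_le_pow_right (by simp) ?_)
  rw [List.length_take]
  omega

section
variable {O : Oracle} {x : Word} {d m e : ℕ} {cM : Config} {w : Word} {s : State Arr} {c : Config}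

theorem SubRep.stamped_qreg (h : SubRep O m e cM .decision w s c) (hblank : ∃ i, c.qreg i = none)
    {i : ℕ} (hi : i ≤ c.queryWord.length) :
    s.stamped .qreg i = symbolCode c.queryWord[i]? := by
  rw [h.qreg, Function.comp_apply, Config.qreg_eq_getElem?_queryWord hblank hi]

theorem exec_copySymbol (h : SubRep O m e cM .decision w s c) (hblank : ∃ i, c.qreg i = none)
    (hm : c.queryWord.length < m) {i : ℕ} (hi : i < c.queryWord.length)
    (hs : CopiedUpTo c i s) :
    ∃ s', Exec O x d copySymbol s copySymbol.cost s' ∧ SubRep O m e cM .decision w s' c ∧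
      CopiedUpTo c (i + 1) s' := by
  have hsymbol := h.stamped_qreg hblank hi.le
  have hask : Exec O x d (.ask (.var (.scratch .pos)) (.stamped .qreg (.var (.scratch .pos)))) s _
      { s with qreg := Function.update s.qreg i c.queryWord[i]? } :=
    .ask hs.pos (by simp [hs.pos, hsymbol, codeSymbol_symbolCode])
  have hstamped : State.stamped { s with qreg := Function.update s.qreg i c.queryWord[i]? }
    .qreg i = _ := hsymbol
  refine ⟨_, hask.seq ((Exec.write rfl (v := revCode (c.queryWord.take (i + 1))) ?_).seq
    (Exec.write rfl (v := i + 1) ?_)), ?_, ?_, ?_, ?_⟩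
  · simp [hs.pos, hs.code, hstamped, revCode_take_succ hi]
  · simp [hs.pos]
  · exact ((h.set_queryRegisters _).set_scratch (size_revCode_take_le hm)).set_scratch
      ((size_le_self _).trans (by omega))
  · simp
  · simp
  · intro j hj
    change Function.update s.qreg i _ j = _
    rcases eq_or_ne j i with rfl | hne
    · simp
    · rw [Function.update_of_ne hne, hs.symbol j (by omega)]

theorem exec_copyLoop (h : SubRep O m e cM .decision w s c) (hblank : ∃ i, c.qreg i = none)
    (hm : c.queryWord.length < m) {i k : ℕ} (hk : c.queryWord.length = i + k)
    (hs : CopiedUpTo c i s) :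
    ∃ s', Exec O x d copyLoop s ((k + 1) * copyLoop.cost) s' ∧ SubRep O m e cM .decision w s' c ∧
      CopiedUpTo c c.queryWord.length s' := by
  induction k generalizing i s with
  | zero =>
    obtain rfl : c.queryWord.length = i := hk
    refine ⟨s, (Exec.loop_exit ?_).mono ?_, h, hs⟩
    · simp [hs.pos, h.stamped_qreg hblank, symbolCode]
    · simp [copyLoop, Cmd.cost]
      omega
  | succ k ih =>
    obtain ⟨s₁, hstep, h₁, hs₁⟩ := exec_copySymbol (x := x) (d := d) h hblank hm (by omega) hs
    obtain ⟨s', hloop, h', hs'⟩ := ih h₁ (by omega) hs₁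
    refine ⟨s', (Exec.loop_step ?_ hstep hloop).mono ?_, h', hs'⟩
    · have hi : i < c.queryWord.length := by omega
      rw [Expr.eval_stamped, Expr.eval, Expr.eval, hs.pos, h.stamped_qreg hblank hi.le,
        List.getElem?_eq_getElem hi]
      cases c.queryWord[i] <;> simp [symbolCode]
    · rw [add_mul (k + 1) 1, add_comm, one_mul]
      exact Nat.add_le_add_left (by simp [copyLoop, Cmd.cost]) _

theorem exec_copyQuery (h : SubRep O m e cM .decision w s c) (hblank : ∃ i, c.qreg i = none)
    (hm : c.queryWord.length < m) (hd : c.queryWord.length ≤ d) :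
    ∃ s', Exec O x d copyQuery s ((d + 1) * copyQuery.cost) s' ∧
      SubRep O m e cM .decision w s' c ∧ s'.queryWord = c.queryWord ∧
      s'.mem (.scratch .code) 0 = revCode c.queryWord := by
  have hsize : (1 : ℕ).size ≤ m := by simpa using (by omega : 1 ≤ m)
  obtain ⟨s₁, hloop, h₁, hs₁⟩ := exec_copyLoop (x := x) (d := d) (i := 0)
    ((h.set_scratch (a := .pos) (v := 0) (by simp)).set_scratch (a := .code) hsize) hblank hm
    (Nat.zero_add _).symm ⟨by simp, by simp [revCode, wordCode], by simp⟩
  have hblankAfter := Exec.ask (O := O) (x := x) (d := d) (s := s₁) (e := .var (.scratch .pos))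
    (f := .const 0) (b := none) (by simpa using hs₁.pos) rfl
  refine ⟨_, ((Exec.write rfl rfl).seq ((Exec.write rfl rfl).seq
    (hloop.seq hblankAfter))).mono ?_, h₁.set_queryRegisters _, ?_, ?_⟩
  · simp only [copyQuery, Cmd.cost]
    nlinarith
  · refine Config.queryWord_eq fun i hi => ?_
    change Function.update s₁.qreg _ none i = _
    rcases hi.eq_or_lt with rfl | hi
    · simp
    · rw [Function.update_of_ne hi.ne, hs₁.symbol i hi]
  · simpa using hs₁.code

theorem exec_locate (h : SubRep O m e cM .decision w s c)
    (hm : c.queryWord.length + 2 + c.asked c.queryWord ≤ m)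
    (hcode : s.mem (.scratch .code) 0 = revCode c.queryWord) :
    Exec O x d locate s locate.cost
        (s.set (.scratch .slot) 0 (cacheAddr c.queryWord (c.asked c.queryWord))) ∧
      SubRep O m e cM .decision w
        (s.set (.scratch .slot) 0 (cacheAddr c.queryWord (c.asked c.queryWord))) c := by
  refine ⟨.write rfl ?_, h.set_scratch ((size_cacheAddr_le _ _).trans hm)⟩
  have hnext := h.next rfl c.queryWord
  by_cases h0 : c.asked c.queryWord = 0
  · simp [hcode, hnext, h0, cacheAddr]
    ring
  · simp [hcode, hnext, h0, (cacheAddr_pos _ _).ne']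

theorem Tidy.query (h : Tidy O m s) {u : Word} (hO : (O u (s.asked u) + 1).size ≤ m) :
    Tidy O m (State.set { s with
      ans := O u (s.asked u)
      asked := Function.update s.asked u (s.asked u + 1) }
        .cache (cacheAddr u (s.asked u)) (O u (s.asked u) + 1)) where
  stamp_le := h.stamp_le
  size := State.size_set h.size hO _ _
  size_ans := size_le_of_le (Nat.le_succ _) hO
  cache v j := by
    have hcache := h.cache v j
    change _ = if j < Function.update s.asked u (s.asked u + 1) v then O v j + 1 else 0
    rw [State.mem_set, Function.update_apply]
    simp only [true_and, cacheAddr_inj]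
    grind

theorem exec_fetch (h : SubRep O m e cM .decision w s c) (hc : AdmissibleQuery O d m c)
    (hquery : s.queryWord = c.queryWord)
    (hslot : s.mem (.scratch .slot) 0 = cacheAddr c.queryWord (c.asked c.queryWord)) :
    ∃ s', Exec O x d fetch s fetch.cost s' ∧ SubRep O m e cM .decision w s' c ∧
      (∀ a, s'.mem (.scratch a) = s.mem (.scratch a)) ∧
      s'.mem .cache (cacheAddr c.queryWord (c.asked c.queryWord)) =
        O c.queryWord (c.asked c.queryWord) + 1 ∧
      c.asked c.queryWord < s'.asked c.queryWord := by
  have hcache := h.tidy.cache c.queryWord (c.asked c.queryWord)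
  rcases (h.asked_le rfl c.queryWord).lt_or_eq with hlt | heq
  · rw [if_pos hlt] at hcache
    refine ⟨s, (Exec.ite_true ?_ .skip).mono ?_, h, fun _ => rfl, hcache, hlt⟩
    · simp [hslot, hcache]
    · simp [fetch, Cmd.cost]
  · have hask := Exec.query (O := O) (x := x) (d := d) (s := s)
      (by rw [hquery]; exact hc.length_le) (by rw [hquery, ← heq]; exact hc.size_answer)
    rw [hquery] at hask
    rw [heq] at hslot ⊢
    rw [heq, if_neg (lt_irrefl _)] at hcache
    have htidy := h.tidy.query (u := c.queryWord) (heq ▸ hc.size_answer_succ)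
    refine ⟨_, (Exec.ite_false ?_ (hask.seq (.write (by simpa using hslot) rfl))).mono ?_,
      { h with
        main := { h.main with }
        tidy := htidy
        input := { h.input with }
        output := { h.output with }
        asked_le := fun _ u => ?_ }, fun _ => rfl, by simp, ?_⟩
    · simp [hslot, hcache]
    · simp [fetch, Cmd.cost]
    · refine (h.asked_le rfl u).trans ?_
      change _ ≤ Function.update s.asked _ _ u
      rw [Function.update_apply]
      split_ifs with hu <;> simp [hu]
    · change _ < Function.update s.asked _ _ _
      simp

theorem exec_deliver (h : SubRep O m e cM .decision w s c)
    (hO : (O c.queryWord (c.asked c.queryWord)).size ≤ m)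
    (hm : c.queryWord.length + 3 + c.asked c.queryWord ≤ m)
    (hcode : s.mem (.scratch .code) 0 = revCode c.queryWord)
    (hslot : s.mem (.scratch .slot) 0 = cacheAddr c.queryWord (c.asked c.queryWord))
    (hcache : s.mem .cache (cacheAddr c.queryWord (c.asked c.queryWord)) =
      O c.queryWord (c.asked c.queryWord) + 1)
    (hasked : c.asked c.queryWord < s.asked c.queryWord) :
    ∃ s', Exec O x d deliver s deliver.cost s' ∧
      SubRep O m e cM .decision w s' { c with
        ans := O c.queryWord (c.asked c.queryWord)
        asked := Function.update c.asked c.queryWord (c.asked c.queryWord + 1) } := by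
  have hnext : SubRep O m e cM .decision w
      (s.setStamped .next (revCode c.queryWord) (cacheAddr c.queryWord (c.asked c.queryWord + 1)))
      { c with asked := Function.update c.asked c.queryWord (c.asked c.queryWord + 1) } :=
    { h with
      main := { h.main with }
      tidy := h.tidy.setStamped ((size_cacheAddr_le _ _).trans (by omega))
      input := { h.input with }
      output := { h.output with }
      next := fun _ u => by
        have := h.next rfl u
        simp only [State.stamped_setStamped, Function.update_apply, revCode_injective.eq_iff]
        split_ifs <;> simp_all
      asked_le := fun _ u => by
        simp only [Function.update_apply]
        split_ifs with hu
        exacts [hu ▸ hasked, h.asked_le rfl u] }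
  refine ⟨_, (Exec.writeStamped hcode ?_).seq (.write rfl ?_), hnext.set_ans hO⟩
  · simp [hslot, cacheAddr_succ]
  · simp [State.setStamped, hslot, hcache]

theorem exec_cachedQuery (h : SubRep O m e cM .decision w s c) (hc : AdmissibleQuery O d m c) :
    ∃ s', Exec O x d cachedQuery s ((d + 1) * cachedQuery.cost) s' ∧
      SubRep O m e cM .decision w s' { c with
        ans := O c.queryWord (c.asked c.queryWord)
        asked := Function.update c.asked c.queryWord (c.asked c.queryWord + 1) } := by
  have hm := hc.length_add_asked_le
  obtain ⟨s₁, hcopy, h₁, hquery, hcode⟩ :=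
    exec_copyQuery (x := x) h hc.blank (by omega) hc.length_le
  obtain ⟨hlocate, h₂⟩ := exec_locate (x := x) (d := d) h₁ (by omega) hcode
  obtain ⟨s₃, hfetch, h₃, hscratch, hcache, hasked⟩ :=
    exec_fetch (x := x) h₂ hc hquery (by simp)
  obtain ⟨s₄, hdeliver, h₄⟩ := exec_deliver (x := x) (d := d) h₃
    (size_le_of_le (Nat.le_succ _) hc.size_answer_succ) hm (by simp [hscratch, hcode])
    (by simp [hscratch]) hcache hasked
  refine ⟨s₄, (hcopy.seq (hlocate.seq (hfetch.seq hdeliver))).mono ?_, h₄⟩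
  simp only [cachedQuery, Cmd.cost]
  nlinarith

end

/-- The access to a subroutine. -/
def Stage.iface (st : Stage) : Iface Arr where
  address := .scratch .address
  value := .scratch .value
  pc := .sub .pc
  ans := .sub .ans
  get := .stamped .reg
  inp e := .cond (.sub (.var (.length st.input)) e) (.mem (.tape st.input) e) (.const 0)
  put := .writeStamped .reg .address (.var (.scratch .value))
  ask := .writeStamped .qreg .address (.norm (.var (.scratch .value)))
  print := .ite (.var (.scratch .value))
    (.seq (.write (.tape st.output) (.var (.length st.output)) (.norm (.var (.scratch .value))))
      (.assign (.length st.output) (.add (.var (.length st.output)) (.const 1))))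
    .skip
  query := match st with
    | .reduction => .assign (.sub .ans) (.const 0)
    | .decision => cachedQuery
  output := .assign (.length st.output) (.const 0)

/-- The oracle of a subroutine. -/
def Stage.oracle (O : Oracle) : Stage → Oracle
  | reduction => noOracle
  | decision => O

section
variable {O : Oracle} {x : Word} {d m e : ℕ} {cM : Config} {st : Stage} {w : Word} {s : State Arr}
  {c : Config}

theorem SubRep.eval_inp (h : SubRep O m e cM st w s c) (f : Expr Arr) :
    (st.iface.inp f).eval x s = symbolCode w[f.eval x s]? := by
  have hlength := h.input.length
  rcases lt_or_ge (f.eval x s) w.length with hlt | hge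
  · simp [Stage.iface, hlength, h.input.symbol _ hlt, Nat.sub_eq_zero_iff_le, hlt.not_ge]
  · simp [Stage.iface, hlength, Nat.sub_eq_zero_of_le hge, hge, symbolCode]

theorem exec_subPrint (h : SubRep O m e cM st w s c) (hm : 2 ≤ m)
    (hlen : (c.out.length + 1).size ≤ m) :
    ∃ s', Exec O x d st.iface.print s st.iface.print.cost s' ∧ SubRep O m e cM st w s'
      { c with out := c.out ++ (codeSymbol (s.mem st.iface.value 0)).toList } := by
  have hlength := h.output.length
  change ∃ s', _ ∧ SubRep O m e cM st w s'
    { c with out := c.out ++ (codeSymbol (s.mem (.scratch .value) 0)).toList }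
  rcases hv : s.mem (.scratch .value) 0 with _ | v
  · refine ⟨s, (Exec.ite_false (by simpa using hv) .skip).mono ?_, by simpa [codeSymbol] using h⟩
    simp [Stage.iface, Cmd.cost]
  · obtain ⟨a, ha⟩ : ∃ a, codeSymbol (v + 1) = some a := by cases v <;> exact ⟨_, rfl⟩
    rw [ha]
    refine ⟨_, (Exec.ite_true (by simp [hv])
      ((Exec.write (by simpa using hlength) (v := symbolCode (some a)) (by simp [hv, ha])).seq
        (Exec.write rfl (v := c.out.length + 1) (by simp [hlength])))).mono ?_,
      h.concat_out hm hlen⟩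
    simp [Stage.iface, Cmd.cost]

theorem exec_subQuery (h : SubRep O m e cM st w s c)
    (hc : st = .decision → AdmissibleQuery O d m c) :
    ∃ s', Exec O x d st.iface.query s ((d + 1) * st.iface.query.cost) s' ∧
      SubRep O m e cM st w s' { c with
        ans := st.oracle O c.queryWord (c.asked c.queryWord)
        asked := Function.update c.asked c.queryWord (c.asked c.queryWord + 1) } := by
  cases st with
  | decision => exact exec_cachedQuery h (hc rfl)
  | reduction =>
    have h' : SubRep O m e cM .reduction w _ _ := h.set_ans (v := 0) (by simp)
    refine ⟨_, (Exec.write rfl rfl).mono ?_,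
      { h' with
        main := { h'.main with }
        tidy := { h'.tidy with }
        next := nofun
        asked_le := nofun }⟩
    exact Nat.le_mul_of_pos_left _ d.succ_pos

theorem Stage.iface_sound (O : Oracle) (x : Word) {d m : ℕ} (hm : 2 ≤ m) (e : ℕ) (cM : Config)
    (st : Stage) (w : Word) :
    st.iface.Sound O x d m (st.oracle O) w (SubRep O m e cM st w)
      (fun c => (c.out.length + 1).size ≤ m) (fun c => st = .decision → AdmissibleQuery O d m c)
      ((d + 1) * st.iface.query.cost) where
  address_ne_value := by simp [Stage.iface]
  get f h := (Expr.eval_stamped ..).trans (congrFun h.reg _)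
  inp f h := h.eval_inp f
  ans h := h.ans
  pc h := h.pc
  set_address h hv := h.set_scratch hv
  set_value h hv := h.set_scratch hv
  set_pc h hv := h.set_pc hv
  put h hv := ⟨_, .writeStamped rfl rfl, h.set_reg hv⟩
  ask h := ⟨_, .writeStamped rfl (by simp [Stage.iface]), h.set_qreg hm⟩
  print h hlen := exec_subPrint h hm hlen
  query h hc := exec_subQuery h hc

end

theorem admissibleQuery_run {P : Program} {O : Oracle} {w : Word} {t d m : ℕ}
    (hr : RegistersBounded P O w d) (hI : P[(run P O w t).pc]? = some .query) (ht : t ≤ d)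
    (hm : 2 * d + 3 ≤ m) : AdmissibleQuery O d m (run P O w t) where
  blank := by
    obtain ⟨i, -, hi⟩ := exists_qreg_eq_none (M := P) (O := O) (x := w) (t := t)
    exact ⟨i, hi⟩
  length_le := length_queryWord_run_le.trans ht
  size_answer := by
    have := (hr (t + 1)).2
    rwa [run_succ_of_getElem? hI] at this
  size_answer_succ := by
    have hans := (hr (t + 1)).2
    rw [run_succ_of_getElem? hI, Nat.size_le] at hans
    refine (Nat.size_le (n := d + 1)).2 ?_ |>.trans (by omega)
    exact (Nat.succ_le_of_lt hans).trans_lt (Nat.pow_lt_pow_right (by simp) (by simp))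
  length_add_asked_le := by
    have hlen := length_queryWord_run_le (M := P) (O := O) (x := w) (t := t)
    have hasked := asked_le (M := P) (O := O) (x := w) (t := t) (run P O w t).queryWord
    omega

/-- Simulation of one step of the subroutine `P`. -/
def Stage.step (st : Stage) (P : Program) : Cmd Arr :=
  st.iface.stepCmd P (.assign (.sub .running) (.const 0))

/-- The subroutine `P` is simulated until it halts. -/
def Stage.loop (st : Stage) (P : Program) : Cmd Arr :=
  .loop (.var (.sub .running)) (st.step P)

/-- A bound for the time to simulate one step of the subroutine `P`. -/
def Stage.stepTime (st : Stage) (P : Program) (d : ℕ) : ℕ :=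
  2 * (st.loop P).cost + (d + 1) * st.iface.query.cost

section
variable {O : Oracle} {x : Word} {d m e : ℕ} {cM : Config} {st : Stage} {w : Word} {s : State Arr}
  {P : Program} {t : ℕ}

theorem exec_subInstr (h : SubRep O m e cM st w s (run P (st.oracle O) w t))
    (hr : RegistersBounded P (st.oracle O) w d) (ht : t < d) {I : Instr}
    (hI : P[(run P (st.oracle O) w t).pc]? = some I) (hm : 2 * d + 3 + Program.bound P ≤ m) :
    ∃ s', Exec O x d (st.iface.instr I) s
        ((st.iface.instr I).cost + (d + 1) * st.iface.query.cost) s' ∧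
      SubRep O m e cM st w s' (run P (st.oracle O) w (t + 1)) := by
  have hJ := st.iface_sound O x (d := d) (by omega : 2 ≤ m) e cM w
  have hsmall := hr.smallStep (m := m) (by omega) ((size_le_self _).trans (by omega)) hI
  have hlen := length_out_le (M := P) (O := st.oracle O) (x := w) (t := t)
  rw [run_succ_of_getElem? hI]
  by_cases hquery : I = .query
  · subst hquery
    obtain ⟨s', hexec, hs'⟩ := hJ.instr_query h
      (by rintro rfl; exact admissibleQuery_run hr hI ht.le (by omega)) hsmall.pc_succ
    refine ⟨s', hexec.mono ?_, hs'⟩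
    simp only [Iface.instr, Cmd.cost]
    omega
  by_cases houtput : I = .output
  · subst houtput
    obtain ⟨s', hnext, hs'⟩ := hJ.next h hsmall.pc_succ
    exact ⟨_, (hnext.seq (.write rfl rfl)).mono (Nat.le_add_right _ _), hs'.clear_out⟩
  obtain ⟨s', hexec, hs'⟩ := hJ.instr h hsmall hquery houtput ((size_le_self _).trans (by omega))
  exact ⟨s', hexec.mono (Nat.le_add_right _ _), hs'⟩

theorem exec_subLoop_halted (h : SubRep O m e cM st w s (run P (st.oracle O) w t))
    (hP : HaltedAt P (st.oracle O) w t) (hm : 2 ≤ m) :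
    Exec O x d (st.loop P) s (st.stepTime P d) (s.set (.sub .running) 0 0) := by
  have hstep := (st.iface_sound O x (d := d) hm e cM w).stepCmd_dead h hP
    (dead := .assign (.sub .running) (.const 0)) (.write rfl rfl)
  refine (Exec.loop_step (by simp [h.running]) hstep (Exec.loop_exit (by simp))).mono ?_
  simp only [Stage.stepTime, Stage.loop, Stage.step, Cmd.cost]
  omega

theorem exec_subLoop (h : SubRep O m e cM st w s (run P (st.oracle O) w t))
    (hr : RegistersBounded P (st.oracle O) w d) {k : ℕ} (hP : HaltedAt P (st.oracle O) w (t + k))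
    (hd : t + k ≤ d) (hm : 2 * d + 3 + Program.bound P ≤ m) :
    ∃ s', Exec O x d (st.loop P) s ((k + 1) * st.stepTime P d) (s'.set (.sub .running) 0 0) ∧
      SubRep O m e cM st w s' (run P (st.oracle O) w (t + k)) := by
  induction k generalizing s t with
  | zero => exact ⟨s, by simpa using exec_subLoop_halted h hP (by omega), h⟩
  | succ k ih =>
    rcases hI : P[(run P (st.oracle O) w t).pc]? with _ | I
    · refine ⟨s, (exec_subLoop_halted h hI (by omega)).mono ?_, ?_⟩
      · exact Nat.le_mul_of_pos_left _ (by omega)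
      · rwa [HaltedAt.run_eq hI (by omega)]
    · obtain ⟨s₁, hinstr, h₁⟩ := exec_subInstr (x := x) h hr (by omega) hI hm
      have hstep := (st.iface_sound O x (d := d) (by omega : 2 ≤ m) e cM w).stepCmd
        (dead := .assign (.sub .running) (.const 0)) h hI hinstr
      obtain ⟨s', hloop, h'⟩ := ih h₁ (by rwa [add_assoc, add_comm 1]) (by omega)
      rw [add_assoc, add_comm 1] at h'
      refine ⟨s', (Exec.loop_step (by simp [h.running]) hstep hloop).mono ?_, h'⟩
      rw [add_mul (k + 1) 1, add_comm ((k + 1) * _), one_mul, Stage.stepTime]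
      refine Nat.add_le_add_right ?_ _
      simp only [Stage.loop, Stage.step, Cmd.cost]
      omega

end

/-- A new epoch begins, and the scalar variables of the subroutine are initialised. -/
def Stage.start (st : Stage) : Cmd Arr :=
  .seq (.assign .epoch (.add (.var .epoch) (.const 1))) <|
  .seq (.assign (.sub .pc) (.const 0)) <|
  .seq (.assign (.sub .ans) (.const 0)) <|
  .seq (.assign (.length st.output) (.const 0)) <|
  .assign (.sub .running) (.const 1)

/-- A complete run of the subroutine `P`. -/
def Stage.call (st : Stage) (P : Program) : Cmd Arr :=
  .seq st.start (st.loop P)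

/-- A bound for the time of a complete run of the subroutine `P`. -/
def Stage.callTime (st : Stage) (P : Program) (d : ℕ) : ℕ :=
  (st.call P).cost + (d + 1) * st.stepTime P d

/-- A run of a subroutine in epoch `e` ended in the configuration `c`, while the enumerator is in
the configuration `cM`. -/
structure CallResult (O : Oracle) (m e : ℕ) (cM : Config) (st : Stage) (s : State Arr)
    (c : Config) : Prop where
  main : MainMem cM s
  tidy : Tidy O m s
  epoch : s.mem .epoch 0 = e
  reg : s.stamped .reg = c.reg
  output : s.Holds st.output c.out

section
variable {O : Oracle} {x : Word} {d m : ℕ} {cM : Config} {st : Stage} {w : Word} {s : State Arr}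

theorem Tidy.set_epoch (h : Tidy O m s) {v : ℕ} (hv : v.size ≤ m) (hle : s.mem .epoch 0 ≤ v) :
    Tidy O m (s.set .epoch 0 v) where
  cache := h.cache
  stamp_le k i := by simpa using (h.stamp_le k i).trans hle
  size := State.size_set h.size hv _ _
  size_ans := h.size_ans

theorem Tidy.stamped_set_epoch (h : Tidy O m s) (k : Volatile) (i : ℕ) :
    (s.set .epoch 0 (s.mem .epoch 0 + 1)).stamped k i = 0 := by
  have := h.stamp_le k i
  exact if_neg (by simp; omega)

theorem exec_subStart (hmain : MainMem cM s) (htidy : Tidy O m s) (hinput : s.Holds st.input w)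
    (hm : (s.mem .epoch 0 + 1).size ≤ m) :
    ∃ s', Exec O x d st.start s st.start.cost s' ∧
      SubRep O m (s.mem .epoch 0 + 1) cM st w s' startConfig := by
  refine ⟨_, (Exec.write rfl rfl).seq ((Exec.write rfl rfl).seq ((Exec.write rfl rfl).seq
    ((Exec.write rfl rfl).seq (Exec.write rfl rfl)))), ?_⟩
  exact {
    main := { hmain with }
    tidy := ((((htidy.set_epoch hm (Nat.le_succ _)).set (by simp)).set (by simp)).set (by simp)).set
      (size_le_of_le (Nat.le_add_left 1 _) hm)
    epoch := rfl
    running := rfl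
    reg := funext fun i => htidy.stamped_set_epoch .reg i
    qreg := funext fun i => htidy.stamped_set_epoch .qreg i
    pc := rfl
    ans := rfl
    input := by cases st <;> exact { hinput with }
    output := { length := by simp [startConfig], symbol := nofun }
    next := fun _ u => htidy.stamped_set_epoch .next _
    asked_le := fun _ _ => Nat.zero_le _ }

theorem exec_subCall {P : Program} (hmain : MainMem cM s) (htidy : Tidy O m s)
    (hinput : s.Holds st.input w) (he : (s.mem .epoch 0 + 1).size ≤ m)
    (hP : HaltedAt P (st.oracle O) w d) (hr : RegistersBounded P (st.oracle O) w d)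
    (hm : 2 * d + 3 + Program.bound P ≤ m) :
    ∃ s', Exec O x d (st.call P) s (st.callTime P d) s' ∧
      CallResult O m (s.mem .epoch 0 + 1) cM st s' (run P (st.oracle O) w d) := by
  obtain ⟨s₁, hstart, h₁⟩ := exec_subStart (x := x) (d := d) hmain htidy hinput he
  obtain ⟨s₂, hloop, h₂⟩ := exec_subLoop (x := x) (t := 0) (k := d) h₁ hr (by rwa [zero_add])
    (zero_add d).le hm
  rw [zero_add] at h₂
  refine ⟨_, (hstart.seq hloop).mono ?_,
    { main := { h₂.main with }
      tidy := h₂.tidy.set (by simp)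
      epoch := h₂.epoch
      reg := h₂.reg
      output := { h₂.output with } }⟩
  simp only [Stage.callTime, Stage.call, Cmd.cost]
  omega

end

/-! ### Simulation of the enumerator -/

/-- The memory represents the configuration `c` of the enumerator, and `e` epochs have begun. -/
structure MainRep (O : Oracle) (m e : ℕ) (s : State Arr) (c : Config) : Prop where
  main : MainMem c s
  tidy : Tidy O m s
  epoch : s.mem .epoch 0 = e

/-- Search for the first blank query register of the enumerator. -/
def queryLengthLoop : Cmd Arr :=
  .loop (.mem (.tape .query) (.var (.length .query)))
    (.assign (.length .query) (.add (.var (.length .query)) (.const 1)))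

/-- Determine the length of the query of the enumerator. -/
def queryLength : Cmd Arr :=
  .seq (.assign (.length .query) (.const 0)) queryLengthLoop

/-- Compute the image of the query of the enumerator under the reduction `F`, and decide it by
means of `D`. -/
def decideQuery (F D : Program) : Cmd Arr :=
  .seq (Stage.reduction.call F) (Stage.decision.call D)

/-- Answer the query of the enumerator. -/
def answerQuery (F D : Program) : Cmd Arr :=
  .seq queryLength <| .seq (decideQuery F D) <|
    .assign (.main .ans) (.cond (.stamped .reg (.const 0)) (.const 1) (.const 0))

/-- A bound for the time to answer a query of the enumerator. -/
def answerQueryTime (F D : Program) (d : ℕ) : ℕ :=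
  (answerQuery F D).cost + (d + 1) * queryLengthLoop.cost + Stage.reduction.callTime F d +
    Stage.decision.callTime D d

/-- With oracle `O`, the reduction `F` followed by the decision procedure `D` decides in time `d`
whether a query of length at most `q` belongs to `L`. -/
def Answers (O : Oracle) (L : DecProblem) (F D : Program) (q d : ℕ) : Prop :=
  ∀ w : Word, w.length ≤ q →
    ∃ y, ComputesWithin F noOracle w y d ∧ DecidesWithin D O y (w ∈ L) d

section
variable {O : Oracle} {x : Word} {q d m e : ℕ} {s : State Arr} {c : Config} {L : DecProblem}
  {F D : Program}

theorem MainRep.set_queryLength (h : MainRep O m e s c) {v : ℕ} (hv : v.size ≤ m) :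
    MainRep O m e (s.set (.length .query) 0 v) c :=
  { h with
    main := { h.main with }
    tidy := h.tidy.set hv }

theorem exec_queryLengthLoop (h : MainRep O m e s c) (hblank : ∃ i, c.qreg i = none)
    (hm : c.queryWord.length.size ≤ m) {i k : ℕ} (hik : i + k = c.queryWord.length)
    (hi : s.mem (.length .query) 0 = i) :
    ∃ s', Exec O x d queryLengthLoop s ((k + 1) * queryLengthLoop.cost) s' ∧
      MainRep O m e s' c ∧ s'.mem (.length .query) 0 = c.queryWord.length := by
  have hsymbol {s i} (h : MainRep O m e s c) (hi : s.mem (.length .query) 0 = i)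
      (hle : i ≤ c.queryWord.length) :
      (Expr.mem (.tape .query) (.var (.length .query))).eval x s = symbolCode c.queryWord[i]? := by
    rw [← c.qreg_eq_getElem?_queryWord hblank hle]
    simp [hi, h.main.qreg]
  induction k generalizing i s with
  | zero =>
    refine ⟨s, (Exec.loop_exit ?_).mono ?_, h, by omega⟩
    · rw [hsymbol h hi (by omega), List.getElem?_eq_none (by omega), symbolCode]
    · simp only [queryLengthLoop, Cmd.cost]
      omega
  | succ k ih =>
    have hrep := h.set_queryLength (v := i + 1) (size_le_of_le (by omega) hm)
    obtain ⟨s', hloop, h'⟩ := ih hrep (i := i + 1) (by omega) (by simp)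
    refine ⟨s', (Exec.loop_step ?_ (Exec.write rfl (by simp [hi])) hloop).mono ?_, h'⟩
    · rw [hsymbol h hi (by omega), List.getElem?_eq_getElem (by omega)]
      cases c.queryWord[i] <;> simp [symbolCode]
    · rw [add_mul (k + 1) 1, add_comm ((k + 1) * _), one_mul]
      exact Nat.add_le_add_right (by simp [queryLengthLoop, Cmd.cost]) _

theorem exec_queryLength (h : MainRep O m e s c) (hblank : ∃ i, c.qreg i = none)
    (hd : c.queryWord.length ≤ d) (hm : d ≤ m) :
    ∃ s', Exec O x d queryLength s (queryLength.cost + (d + 1) * queryLengthLoop.cost) s' ∧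
      MainRep O m e s' c ∧ s'.Holds .query c.queryWord := by
  have hsize : c.queryWord.length.size ≤ m :=
    (size_le_self _).trans (hd.trans hm)
  obtain ⟨s', hloop, h', hlength⟩ := exec_queryLengthLoop (x := x) (d := d)
    (h.set_queryLength (v := 0) (by simp)) hblank hsize (zero_add _) (by simp)
  refine ⟨s', ((Exec.write rfl rfl).seq hloop).mono ?_, h', ?_⟩
  · have := Nat.mul_le_mul_right queryLengthLoop.cost (Nat.add_le_add_right hd 1)
    simp only [queryLength, Cmd.cost]
    omega
  · exact ⟨hlength, fun i hi => by
      rw [← c.qreg_eq_getElem?_queryWord hblank hi.le, h'.main.qreg, Function.comp_apply]⟩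

theorem exec_decideQuery (h : MainRep O m e s c) (hw : s.Holds .query c.queryWord)
    (hFD : Answers O L F D q d) (hq : c.queryWord.length ≤ q) (he : (e + 2).size ≤ m)
    (hm : 2 * d + 3 + Program.bound F + Program.bound D ≤ m) :
    ∃ s', Exec O x d (decideQuery F D) s
        (Stage.reduction.callTime F d + Stage.decision.callTime D d) s' ∧
      MainRep O m (e + 2) s' c ∧ (c.queryWord ∈ L ↔ s'.stamped .reg 0 ≠ 0) := by
  obtain ⟨y, ⟨hFhalted, hFout, hFreg⟩, hDhalted, hDaccept, hDreg⟩ := hFD _ hq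
  obtain ⟨s₁, hexec₁, h₁⟩ := exec_subCall (st := .reduction) (O := O) (x := x) h.main h.tidy hw
    (size_le_of_le (by rw [h.epoch]; omega) he) hFhalted hFreg (by omega)
  have hy : s₁.Holds .image y := hFout ▸ h₁.output
  have hepoch : s₁.mem .epoch 0 + 1 = e + 2 := by rw [h₁.epoch, h.epoch]
  obtain ⟨s₂, hexec₂, h₂⟩ := exec_subCall (st := .decision) (x := x) h₁.main h₁.tidy hy
    (by rwa [hepoch]) hDhalted hDreg (by omega)
  refine ⟨s₂, hexec₁.seq hexec₂, ⟨h₂.main, h₂.tidy, h₂.epoch.trans hepoch⟩, ?_⟩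
  rw [h₂.reg]
  exact hDaccept

theorem exec_answerQuery (h : MainRep O m e s c) (hblank : ∃ i, c.qreg i = none)
    (hFD : Answers O L F D q d) (hq : c.queryWord.length ≤ q) (hd : q ≤ d) (he : (e + 2).size ≤ m)
    (hm : 2 * d + 3 + Program.bound F + Program.bound D ≤ m) (j : ℕ) (asked : Word → ℕ) :
    ∃ s', Exec O x d (answerQuery F D) s (answerQueryTime F D d) s' ∧
      MainRep O m (e + 2) s' { c with ans := decOracle L c.queryWord j, asked := asked } := by
  obtain ⟨s₁, hlength, h₁, hw⟩ := exec_queryLength (x := x) h hblank (hq.trans hd) (by omega)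
  obtain ⟨s₂, hdecide, h₂, hreg⟩ := exec_decideQuery (x := x) h₁ hw hFD hq he hm
  have hans : (Expr.cond (.stamped .reg (.const 0)) (.const 1) (.const 0)).eval x s₂ =
      decOracle L c.queryWord j := by
    by_cases hL : c.queryWord ∈ L
    · simp [decOracle, hL, hreg.1 hL]
    · simp [decOracle, hL, not_not.1 (mt hreg.2 hL)]
  have hsize : (decOracle L c.queryWord j).size ≤ m :=
    size_le_of_le (b := 1) (by unfold decOracle; split_ifs <;> simp) (by rw [Nat.size_one]; omega)
  refine ⟨_, (hlength.seq (hdecide.seq (Exec.write rfl hans))).mono ?_,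
    { main := { h₂.main with ans := by simp }
      tidy := h₂.tidy.set hsize
      epoch := h₂.epoch }⟩
  simp only [answerQueryTime, answerQuery, Cmd.cost]
  omega

end

/-- The access to the enumerator. An output is announced by a flag. -/
def mainIface (F D : Program) : Iface Arr where
  address := .scratch .address
  value := .scratch .value
  pc := .main .pc
  ans := .main .ans
  get := .mem (.main .reg)
  inp := .input
  put := .write (.main .reg) (.var (.scratch .address)) (.var (.scratch .value))
  ask := .write (.tape .query) (.var (.scratch .address)) (.norm (.var (.scratch .value)))
  print := .print (.var (.scratch .value))
  query := answerQuery F D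
  output := .seq (.assign (.main .halted) (.const 1)) (.assign (.main .emit) (.const 1))

section
variable {O : Oracle} {x : Word} {q d m e : ℕ} {s : State Arr} {c : Config} {L : DecProblem}
  {M F D : Program}

theorem MainRep.set_scratch (h : MainRep O m e s c) {a : Scratch} {v : ℕ} (hv : v.size ≤ m) :
    MainRep O m e (s.set (.scratch a) 0 v) c :=
  { h with
    main := { h.main with }
    tidy := h.tidy.set hv }

theorem MainRep.set_pc (h : MainRep O m e s c) {v : ℕ} (hv : v.size ≤ m) :
    MainRep O m e (s.set (.main .pc) 0 v) { c with pc := v } :=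
  { h with
    main := { h.main with pc := by simp }
    tidy := h.tidy.set hv }

theorem MainRep.set_reg (h : MainRep O m e s c) {i v : ℕ} (hv : v.size ≤ m) :
    MainRep O m e (s.set (.main .reg) i v) { c with reg := Function.update c.reg i v } :=
  { h with
    main := { h.main with reg := by rw [State.mem_set_self, h.main.reg] }
    tidy := h.tidy.set hv }

theorem MainRep.set_qreg (h : MainRep O m e s c) {i : ℕ} {a : Option Bool} (hm : 2 ≤ m) :
    MainRep O m e (s.set (.tape .query) i (symbolCode a))
      { c with qreg := Function.update c.qreg i a } :=
  { h with
    main := { h.main with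
      qreg := by rw [State.mem_set_self, h.main.qreg, Function.comp_update] }
    tidy := h.tidy.set (size_symbolCode_le hm a) }

theorem MainRep.append_out (h : MainRep O m e s c) (v : Word) :
    MainRep O m e { s with out := s.out ++ v } { c with out := c.out ++ v } :=
  { h with
    main := { h.main with out := by rw [h.main.out] }
    tidy := { h.tidy with } }

/-- A query changes the epoch and hence is not covered. -/
theorem mainIface_sound (O : Oracle) (x : Word) {d m : ℕ} (hm : 2 ≤ m) (e : ℕ) (OV : Oracle)
    (F D : Program) (N : ℕ) :
    (mainIface F D).Sound O x d m OV x (MainRep O m e) (fun _ => True) (fun _ => False) N where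
  address_ne_value := by simp [mainIface]
  get f h := congrFun h.main.reg _
  inp f _ := rfl
  ans h := h.main.ans
  pc h := h.main.pc
  set_address h hv := h.set_scratch hv
  set_value h hv := h.set_scratch hv
  set_pc h hv := h.set_pc hv
  put h hv := ⟨_, .write rfl rfl, h.set_reg hv⟩
  ask h := ⟨_, .write rfl (by simp [mainIface]), h.set_qreg hm⟩
  print h _ := ⟨_, .print rfl, h.append_out _⟩
  query _ hfalse := hfalse.elim

/-- Raise the flags that announce an output. -/
def State.raiseFlags (s : State Arr) : State Arr :=
  (s.set (.main .halted) 0 1).set (.main .emit) 0 1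

/-- Simulation of one step of the enumerator `M`. If `M` has halted, the flag `halted` is set; if
`M` outputs a word, the flags `halted` and `emit` are set. -/
def mainStep (M F D : Program) : Cmd Arr :=
  (mainIface F D).stepCmd M (.assign (.main .halted) (.const 1))

/-- A bound for the time to simulate one step of the enumerator. -/
def mainStepTime (M F D : Program) (d : ℕ) : ℕ :=
  2 * (mainStep M F D).cost + answerQueryTime F D d

theorem exec_mainStep_halted (h : MainRep O m e s c) (hM : M[c.pc]? = none) (hm : 2 ≤ m) :
    Exec O x d (mainStep M F D) s (mainStepTime M F D d) (s.set (.main .halted) 0 1) :=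
  ((mainIface_sound O x hm e noOracle F D 0).stepCmd_dead h hM (.write rfl rfl)).mono
    (Nat.le_add_right _ _)

theorem exec_mainStep_output (h : MainRep O m e s c) (hM : M[c.pc]? = some .output) (hm : 2 ≤ m)
    (hpc : (c.pc + 1).size ≤ m) :
    ∃ s', Exec O x d (mainStep M F D) s (mainStepTime M F D d) s'.raiseFlags ∧
      MainRep O m e s' c.next := by
  have hJ := mainIface_sound O x (d := d) hm e noOracle F D 0
  obtain ⟨s', hnext, h'⟩ := hJ.next h hpc
  refine ⟨s', (hJ.stepCmd h hM (n := answerQueryTime F D d) ?_).mono le_rfl, h'⟩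
  exact (hnext.seq ((Exec.write rfl rfl).seq (.write rfl rfl))).mono (Nat.le_add_right _ _)

theorem exec_mainStep_query (h : MainRep O m e s c) (hM : M[c.pc]? = some .query)
    (hblank : ∃ i, c.qreg i = none) (hFD : Answers O L F D q d) (hq : c.queryWord.length ≤ q)
    (hd : q ≤ d) (he : (e + 2).size ≤ m) (hm : 2 * d + 3 + Program.bound F + Program.bound D ≤ m)
    (hpc : (c.pc + 1).size ≤ m) :
    ∃ s', Exec O x d (mainStep M F D) s (mainStepTime M F D d) s' ∧
      MainRep O m (e + 2) s' (Instr.query.exec (decOracle L) x c) := by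
  have hJ := fun e => mainIface_sound O x (d := d) (by omega : 2 ≤ m) e (decOracle L) F D 0
  obtain ⟨s', hexec, h'⟩ := (hJ (e + 2)).seq_next
    (exec_answerQuery (x := x) h hblank hFD hq hd he hm (c.asked c.queryWord)
      (Function.update c.asked c.queryWord (c.asked c.queryWord + 1))) hpc
  refine ⟨s', (hJ e).stepCmd h hM (hexec.mono ?_), h'⟩
  simp only [Iface.instr, Cmd.cost]
  omega

theorem exec_mainStep {I : Instr} {OV : Oracle} (h : MainRep O m e s c) (hM : M[c.pc]? = some I)
    (hI : SmallStep OV x m I c) (hquery : I ≠ .query) (houtput : I ≠ .output) (hm : 2 ≤ m) :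
    ∃ s', Exec O x d (mainStep M F D) s (mainStepTime M F D d) s' ∧
      MainRep O m e s' (I.exec OV x c) := by
  have hJ := mainIface_sound O x (d := d) hm e OV F D 0
  obtain ⟨s', hinstr, h'⟩ := hJ.instr h hI hquery houtput trivial
  exact ⟨s', hJ.stepCmd h hM (hinstr.mono (Nat.le_add_right _ _)), h'⟩

end

/-! ### Simulation in windows of time -/

/-- The contents of the work registers and of the answer register have at most `m` digits. -/
def Config.SizeLe (c : Config) (m : ℕ) : Prop :=
  (∀ i, (c.reg i).size ≤ m) ∧ c.ans.size ≤ m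

/-- In the steps `a, …, b - 1` the machine `P` with oracle `O` simulates step `t` of the machine `M`
with oracle `OV`. A word that `M` outputs in this step is output by `P` in step `b - 1`. -/
structure Window (M : Program) (OV : Oracle) (P : Program) (O : Oracle) (x : Word) (d m t a b : ℕ) :
    Prop where
  lt : a < b
  output : ∀ i ∈ Set.Ico a b, ∀ y, OutputsAt P O x i y ↔ i + 1 = b ∧ OutputsAt M OV x t y
  query : ∀ i ∈ Set.Ico a b, ∀ w, QueriesAt P O x i w → w.length ≤ d
  size : ∀ i ∈ Set.Ico a b, (run P O x i).SizeLe m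
  halted : HaltedAt M OV x t → HaltedAt P O x b

section
variable {M P : Program} {O OV : Oracle} {x : Word} {d k m n t a b : ℕ} {c : Config}
  {y : Word}

theorem Config.SizeLe.mono (h : c.SizeLe m) (hk : m ≤ k) : c.SizeLe k :=
  ⟨fun i => (h.1 i).trans hk, h.2.trans hk⟩

theorem Config.SizeLe.set (h : c.SizeLe m) {v : ℕ} (hv : v.size ≤ m) (i : ℕ) :
    (c.set i v).SizeLe m := by
  refine ⟨fun j => ?_, h.2⟩
  simp only [Config.set, Function.update_apply]
  split_ifs
  exacts [hv, h.1 j]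

theorem size_add_le {u v : ℕ} (hu : u.size ≤ m) (hv : v.size ≤ m) : (u + v).size ≤ m + 1 := by
  rw [Nat.size_le] at *
  rw [pow_succ]
  omega

theorem Config.SizeLe.exec (h : c.SizeLe m) (hm : 2 ≤ m) {I : Instr} (hI : I.numerals.size ≤ m)
    (hquery : I = .query → (O c.queryWord (c.asked c.queryWord)).size ≤ m) :
    (I.exec O x c).SizeLe (m + 1) := by
  have h' : c.SizeLe (m + 1) := h.mono (Nat.le_succ m)
  have hset {v : ℕ} (hv : v.size ≤ m) (i : ℕ) : (c.set i v).SizeLe (m + 1) :=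
    (h.set hv i).mono (Nat.le_succ m)
  cases I with
  | const i n => exact hset (size_le_of_le (by simp [Instr.numerals]) hI) i
  | add i j l => exact h'.set (size_add_le (h.1 j) (h.1 l)) i
  | sub i j l => exact hset (size_le_of_le (Nat.sub_le ..) (h.1 j)) i
  | half i j => exact hset (size_le_of_le (Nat.div_le_self ..) (h.1 j)) i
  | load i j => exact hset (h.1 _) i
  | store i j => exact hset (h.1 j) _
  | input i j => exact hset (size_symbolCode_le hm _) i
  | answer i => exact hset h.2 i
  | query => exact ⟨h'.1, (hquery rfl).trans (Nat.le_succ m)⟩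
  | jumpZero i l =>
    rw [Instr.exec]
    split_ifs <;> exact h'
  | _ => exact h'

theorem Config.SizeLe.step (h : c.SizeLe m) (hP : (Program.bound P).size ≤ m) (hm : 2 ≤ m)
    (hquery : P[c.pc]? = some .query → (O c.queryWord (c.asked c.queryWord)).size ≤ m) :
    (step P O x c).SizeLe (m + 1) := by
  rw [EnumComplexity.step]
  split
  · exact h.mono (Nat.le_succ m)
  · rename_i I hI
    exact h.exec hm (size_le_of_le (numerals_le_bound (List.mem_of_getElem? hI)) hP)
      fun hIquery => hquery (hIquery ▸ hI)

theorem Config.SizeLe.iterate_step (h : c.SizeLe m) (hP : (Program.bound P).size ≤ m) (hm : 2 ≤ m)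
    (hd : d ≤ m) (hquiet : ∀ j < n, Quiet P O d ((EnumComplexity.step P O x)^[j] c)) :
    ((EnumComplexity.step P O x)^[n] c).SizeLe (m + n) := by
  induction n with
  | zero => exact h
  | succ n ih =>
    rw [Function.iterate_succ_apply']
    refine (ih fun j hj => hquiet j (by omega)).step (hP.trans (by omega)) (by omega) fun hI => ?_
    exact ((hquiet n n.lt_succ_self).2 hI).2.trans (by omega)

theorem run_add (a n : ℕ) : run P O x (a + n) = (step P O x)^[n] (run P O x a) := by
  rw [run, run, add_comm, Function.iterate_add_apply]

theorem Window.of_quietRun (hrun : QuietRun P O x d (run P O x a) n c)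
    (hsize : (run P O x a).SizeLe m) (hP : (Program.bound P).size ≤ m) (hm : 2 ≤ m) (hd : d ≤ m)
    (hquery : P[c.pc]? ≠ some .query)
    (houtput : ∀ y, (P[c.pc]? = some .output ∧ c.out = y) ↔ OutputsAt M OV x t y)
    (hhalted : HaltedAt M OV x t → P[(step P O x c).pc]? = none) :
    ∃ b ≤ a + n + 1, run P O x b = step P O x c ∧ Window M OV P O x d (m + n) t a b := by
  obtain ⟨k, hk, rfl, hquiet⟩ := hrun
  rw [← run_add] at *
  have hlast : run P O x (a + k + 1) = step P O x (run P O x (a + k)) := run_succ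
  have hquiet {i : ℕ} (hi : a ≤ i) (hik : i < a + k) : Quiet P O d (run P O x i) := by
    obtain ⟨j, rfl⟩ := Nat.exists_eq_add_of_le hi
    rw [run_add]
    exact hquiet j (by omega)
  refine ⟨a + k + 1, by omega, hlast, ⟨by omega, ?_, ?_, ?_, ?_⟩⟩
  · rintro i ⟨hi, hik⟩ y
    rcases (Nat.lt_succ_iff.1 hik).lt_or_eq with hik | rfl
    · exact ⟨fun h => absurd h.1 (hquiet hi hik).1, fun h => by omega⟩
    · exact (houtput y).trans (by simp)
  · rintro i ⟨hi, hik⟩ w ⟨hI, rfl⟩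
    rcases (Nat.lt_succ_iff.1 hik).lt_or_eq with hik | rfl
    · exact ((hquiet hi hik).2 hI).1
    · exact absurd hI hquery
  · rintro i ⟨hi, hik⟩
    obtain ⟨j, rfl⟩ := Nat.exists_eq_add_of_le hi
    rw [run_add]
    refine (hsize.iterate_step hP hm hd fun l hl => ?_).mono (by omega)
    rw [← run_add]
    exact hquiet (by omega) (by omega)
  · intro h
    rw [HaltedAt, hlast]
    exact hhalted h

theorem HaltedAt.not_outputsAt (h : HaltedAt M O x t) : ¬ OutputsAt M O x t y := by
  rw [HaltedAt] at h
  simp [OutputsAt, h]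

theorem Window.of_halted (hM : HaltedAt M OV x t) (hP : HaltedAt P O x a)
    (hsize : (run P O x a).SizeLe m) : Window M OV P O x d m t a (a + 1) := by
  have hIco {i : ℕ} (hi : i ∈ Set.Ico a (a + 1)) : i = a := by
    simp only [Set.mem_Ico] at hi
    omega
  have hP' : P[(run P O x a).pc]? = none := hP
  refine ⟨by omega, fun i hi => ?_, fun i hi => ?_, fun i hi => ?_, fun _ => hP.mono (by omega)⟩
  · simp [hIco hi, hM.not_outputsAt, hP.not_outputsAt]
  · simp [hIco hi, QueriesAt, hP']
  · rwa [hIco hi]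

end

/-- The machine `P` simulates all steps of the machine `M`, step `t` of `M` in the window from `τ t`
to `τ (t + 1)`. The windows have length at most `K`. -/
structure Schedule (M : Program) (OV : Oracle) (P : Program) (O : Oracle) (x : Word) (d m K : ℕ)
    (τ : ℕ → ℕ) : Prop where
  zero : τ 0 = 0
  succ_le : ∀ t, τ (t + 1) ≤ τ t + K
  window : ∀ t, Window M OV P O x d m t (τ t) (τ (t + 1))

namespace Schedule

variable {M P : Program} {O OV : Oracle} {x : Word} {S : Set Word} {d m K q i t : ℕ} {y : Word}
  {τ : ℕ → ℕ}

theorem strictMono (h : Schedule M OV P O x d m K τ) : StrictMono τ :=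
  strictMono_nat_of_lt_succ fun t => (h.window t).lt

theorem exists_mem_Ico (h : Schedule M OV P O x d m K τ) (i : ℕ) :
    ∃ t, i ∈ Set.Ico (τ t) (τ (t + 1)) := by
  have hcover := iUnion_Ico_map_succ_eq_Ici (fun t => h.strictMono.monotone (bot_le (a := t)))
    h.strictMono.not_bddAbove_range_of_isSuccArchimedean
  have hi : i ∈ Set.Ici (τ ⊥) := by simp [h.zero]
  rw [← hcover] at hi
  simpa using hi

theorem le_add_mul (h : Schedule M OV P O x d m K τ) (t n : ℕ) : τ (t + n) ≤ τ t + n * K := by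
  induction n with
  | zero => simp
  | succ n ih =>
    have hsucc := h.succ_le (t + n)
    rw [← add_assoc, add_mul]
    omega

theorem outputsAt_iff (h : Schedule M OV P O x d m K τ) :
    OutputsAt P O x i y ↔ ∃ t, i + 1 = τ (t + 1) ∧ OutputsAt M OV x t y := by
  constructor
  · obtain ⟨t, hi⟩ := h.exists_mem_Ico i
    exact fun hy => ⟨t, ((h.window t).output i hi y).1 hy⟩
  · rintro ⟨t, hi, hy⟩
    have hlt := (h.window t).lt
    exact ((h.window t).output i ⟨by omega, by omega⟩ y).2 ⟨hi, hy⟩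

theorem exists_halted_or_outputsAt (h : Schedule M OV P O x d m K τ)
    (hM : ∀ t, ∃ s, t ≤ s ∧ s ≤ t + q ∧ (HaltedAt M OV x s ∨ ∃ y, OutputsAt M OV x s y)) (i : ℕ) :
    ∃ s, i ≤ s ∧ s ≤ i + (q + 1) * K ∧ (HaltedAt P O x s ∨ ∃ y, OutputsAt P O x s y) := by
  obtain ⟨t, hti, hit⟩ := h.exists_mem_Ico i
  obtain ⟨s, hts, hst, hs⟩ := hM t
  have hupper : τ (s + 1) ≤ τ t + (q + 1) * K := by
    obtain ⟨n, rfl⟩ := Nat.exists_eq_add_of_le hts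
    exact (h.le_add_mul t (n + 1)).trans (by gcongr; omega)
  have hlower : τ (t + 1) ≤ τ (s + 1) := h.strictMono.monotone (by omega)
  rcases hs with hs | ⟨y, hy⟩
  · exact ⟨τ (s + 1), by omega, by omega, .inl ((h.window s).halted hs)⟩
  · exact ⟨τ (s + 1) - 1, by omega, by omega, .inr ⟨y, h.outputsAt_iff.2 ⟨s, by omega, hy⟩⟩⟩

theorem enumeratesWithin (h : Schedule M OV P O x d m K τ) (hM : EnumeratesWithin M OV x S q)
    {B : ℕ} (hK : (q + 1) * K ≤ B) (hd : d ≤ B) (hm : m ≤ B) : EnumeratesWithin P O x S B := by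
  obtain ⟨hmem, hunique, hdelay, -⟩ := hM
  refine ⟨fun y => (hmem y).trans ⟨?_, ?_⟩, ?_, ?_, ?_, ?_⟩
  · rintro ⟨t, hy⟩
    exact ⟨τ (t + 1) - 1, h.outputsAt_iff.2 ⟨t, by have := (h.window t).lt; omega, hy⟩⟩
  · rintro ⟨i, hy⟩
    obtain ⟨t, -, hy⟩ := h.outputsAt_iff.1 hy
    exact ⟨t, hy⟩
  · intro i i' y hy hy'
    obtain ⟨t, hi, hy⟩ := h.outputsAt_iff.1 hy
    obtain ⟨t', hi', hy'⟩ := h.outputsAt_iff.1 hy'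
    obtain rfl := hunique t t' y hy hy'
    omega
  · intro i
    obtain ⟨s, his, hsi, hs⟩ := h.exists_halted_or_outputsAt hdelay i
    exact ⟨s, his, hsi.trans (by omega), hs⟩
  · intro i w hw
    obtain ⟨t, hi⟩ := h.exists_mem_Ico i
    exact ((h.window t).query i hi w hw).trans hd
  · intro i
    obtain ⟨t, hi⟩ := h.exists_mem_Ico i
    exact ((h.window t).size i hi).mono hm

end Schedule

/-! ### The length of enumerations -/

section
variable {M : Program} {O : Oracle} {x : Word} {S : Set Word} {d t : ℕ} {y : Word}

theorem EnumeratesWithin.length_le (h : EnumeratesWithin M O x S d) (hy : OutputsAt M O x t y) :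
    y.length ≤ d := by
  rcases le_or_gt t d with htd | htd
  · exact hy.2 ▸ length_out_le.trans htd
  · obtain ⟨u, hu, hud, hhalted | ⟨z, hz, -⟩⟩ := h.2.2.1 (t - d - 1)
    · exact absurd hy (hhalted.mono (by omega)).not_outputsAt
    · have hempty : (run M O x (u + 1)).out = [] := by
        rw [run_succ_of_getElem? hz]
        rfl
      have hlength := length_out_add_le (M := M) (O := O) (x := x) (t := u + 1) (t - u - 1)
      rw [hempty, show u + 1 + (t - u - 1) = t by omega, hy.2, List.length_nil] at hlength
      omega

theorem EnumeratesWithin.exists_outputsAt_of_not_halted (h : EnumeratesWithin M O x S d)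
    (ht : ¬ HaltedAt M O x t) {k : ℕ} (hk : (k + 1) * (d + 1) ≤ t + 1) :
    ∃ u y, u / (d + 1) = k ∧ OutputsAt M O x u y := by
  obtain ⟨u, hu, hud, hhalted | ⟨y, hy⟩⟩ := h.2.2.1 (k * (d + 1))
  · rw [add_mul] at hk
    exact absurd (hhalted.mono (by omega)) ht
  · refine ⟨u, y, ?_, hy⟩
    rw [Nat.div_eq_iff (by omega)]
    omega

theorem EnumeratesWithin.succ_lt_of_not_halted (h : EnumeratesWithin M O x S d)
    (ht : ¬ HaltedAt M O x t) : t + 1 < (2 ^ (d + 1) + 1) * (d + 1) := by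
  have hoff : ∀ k : Fin ((t + 1) / (d + 1)), ∃ u y, u / (d + 1) = k ∧ OutputsAt M O x u y :=
    fun k => h.exists_outputsAt_of_not_halted ht
      ((Nat.mul_le_mul_right _ k.2).trans (Nat.div_mul_le_self _ _))
  choose u y hu hy using hoff
  have hcode (k) : revCode (y k) < 2 ^ (d + 1) :=
    (revCode_lt _).trans_le (Nat.pow_le_pow_right two_pos (Nat.succ_le_succ (h.length_le (hy k))))
  have hinj : Function.Injective fun k => (⟨revCode (y k), hcode k⟩ : Fin (2 ^ (d + 1))) := by
    intro k k' hk
    have hyy : y k = y k' := revCode_injective (congrArg Fin.val hk)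
    have huu : u k = u k' := h.2.1 _ _ (y k) (hy k) (hyy ▸ hy k')
    rw [Fin.ext_iff, ← hu, ← hu, huu]
  have hcard := Fintype.card_le_of_injective _ hinj
  rw [Fintype.card_fin, Fintype.card_fin] at hcard
  exact (Nat.div_lt_iff_lt_mul d.succ_pos).1 (Nat.lt_succ_of_le hcard)

theorem EnumeratesWithin.size_le_of_not_halted (h : EnumeratesWithin M O x S d)
    (ht : ¬ HaltedAt M O x t) : (2 * t + 2).size ≤ 2 * d + 3 := by
  have hlength : d + 1 ≤ 2 ^ d := Nat.lt_two_pow_self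
  have hblocks : 2 ^ (d + 1) + 1 ≤ 2 ^ (d + 2) := by
    rw [pow_succ 2 (d + 1)]
    have := Nat.one_le_two_pow (n := d + 1)
    omega
  rw [Nat.size_le]
  calc 2 * t + 2 = 2 * (t + 1) := by ring
    _ < 2 * ((2 ^ (d + 1) + 1) * (d + 1)) := by
      have := h.succ_lt_of_not_halted ht
      omega
    _ ≤ 2 * (2 ^ (d + 2) * 2 ^ d) := by gcongr
    _ = 2 ^ (2 * d + 3) := by ring

end

/-! ### The simulating machine -/

/-- Lower the flags that tell that the enumerator has halted or is about to output a word. -/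
def State.clearFlags (s : State Arr) : State Arr :=
  (s.set (.main .halted) 0 0).set (.main .emit) 0 0

/-- Lower the flags and simulate one step of the enumerator. -/
def mainCycle (M F D : Program) : Cmd Arr :=
  .seq (.seq (.assign (.main .halted) (.const 0)) (.assign (.main .emit) (.const 0)))
    (mainStep M F D)

/-- The machine that simulates the enumerator `M` and has its queries answered by the reduction `F`
and the decision procedure `D`. -/
noncomputable def mainProgram (M F D : Program) : Program :=
  (mainCycle M F D).code 0 ++
    [.jumpZero (addr (.main .halted : Arr) 0) 0,
      .jumpZero (addr (.main .emit : Arr) 0) ((mainCycle M F D).cost + 4), .output, .jump 0]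

/-- A bound for the time between the simulations of consecutive steps of the enumerator. -/
def mainCycleTime (M F D : Program) (d : ℕ) : ℕ :=
  (mainCycle M F D).cost + mainStepTime M F D d + 3

/-- A bound for the number of digits in the registers of the simulating machine at the beginning of
each cycle. -/
noncomputable def digits (M F D : Program) (d : ℕ) : ℕ :=
  2 * d + 3 + Program.bound M + Program.bound F + Program.bound D +
    Program.bound (mainProgram M F D)

/-- A bound for the delay of the simulating machine. -/
noncomputable def delay (M F D : Program) (d : ℕ) : ℕ :=
  digits M F D d + (d + 1) * (mainCycleTime M F D d + 1)

/-- After `a` steps the simulating machine has completed the simulation of `t` steps of the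
enumerator: it is about to begin its next cycle, possibly after a jump, or both machines have
halted. -/
def Sync (O : Oracle) (L : DecProblem) (M F D : Program) (x : Word) (d t a : ℕ) : Prop :=
  (run (mainProgram M F D) O x a).SizeLe (digits M F D d) ∧
    ((∃ s : State Arr, ∃ e ≤ 2 * t,
        QuietRun (mainProgram M F D) O x d (run (mainProgram M F D) O x a) 1 (s.config 0) ∧
        MainRep O (digits M F D d) e s.clearFlags (run M (decOracle L) x t)) ∨
      HaltedAt (mainProgram M F D) O x a ∧ HaltedAt M (decOracle L) x t)

section
variable {O : Oracle} {x : Word} {q d m e t a : ℕ} {s s' : State Arr} {c : Config}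
  {L : DecProblem} {M F D : Program} {S : Set Word}

theorem MainRep.clearFlags (h : MainRep O m e s c) : MainRep O m e s.clearFlags c :=
  { h with
    main := { h.main with
      halted := by simp [State.clearFlags]
      emit := by simp [State.clearFlags] }
    tidy := (h.tidy.set (by simp)).set (by simp) }

theorem Tidy.sizeLe_config (h : Tidy O m s) (b : ℕ) : (s.config b).SizeLe m := by
  refine ⟨fun i => ?_, h.size_ans⟩
  change (s.phys i).size ≤ m
  by_cases hi : ∃ (r : Arr) (j : ℕ), addr r j = i
  · obtain ⟨r, j, rfl⟩ := hi
    rw [s.phys_addr]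
    exact h.size r j
  · push Not at hi
    simp [s.phys_of_ne hi]

theorem codeAt_mainProgram :
    CodeAt (mainProgram M F D) 0 ((mainCycle M F D).code 0) ∧
    (mainProgram M F D)[(mainCycle M F D).cost]? =
      some (.jumpZero (addr (.main .halted : Arr) 0) 0) ∧
    (mainProgram M F D)[(mainCycle M F D).cost + 1]? =
      some (.jumpZero (addr (.main .emit : Arr) 0) ((mainCycle M F D).cost + 4)) ∧
    (mainProgram M F D)[(mainCycle M F D).cost + 2]? = some .output ∧
    (mainProgram M F D)[(mainCycle M F D).cost + 3]? = some (.jump 0) ∧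
    (mainProgram M F D)[(mainCycle M F D).cost + 4]? = none := by
  have h : CodeAt (mainProgram M F D) 0 (mainProgram M F D) := fun i _ => by rw [zero_add]
  nth_rw 2 [mainProgram] at h
  simp only [codeAt_append, codeAt_cons, Cmd.length_code, zero_add] at h
  obtain ⟨hcycle, hhalted, hemit, houtput, hjump, -⟩ := h
  exact ⟨hcycle, hhalted, hemit, houtput, hjump, by simp [mainProgram, Cmd.length_code]⟩

theorem quietRun_mainCycle (hc : QuietRun (mainProgram M F D) O x d c 1 (s.config 0))
    (hstep : Exec O x d (mainStep M F D) s.clearFlags (mainStepTime M F D d) s') :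
    QuietRun (mainProgram M F D) O x d c ((mainCycle M F D).cost + mainStepTime M F D d + 1)
      (s'.config (mainCycle M F D).cost) := by
  have hcycle : Exec O x d (mainCycle M F D) s _ s' :=
    ((Exec.write rfl rfl).seq (.write rfl rfl)).seq hstep
  refine (hc.trans (hcycle _ 0 codeAt_mainProgram.1)).congr ?_ (by rw [zero_add])
  simp only [mainCycle, Cmd.cost]
  omega

theorem step_of_halted_eq_zero (h : s.mem (.main .halted) 0 = 0) :
    step (mainProgram M F D) O x (s.config (mainCycle M F D).cost) = s.config 0 := by
  simp [step, State.config, State.withReg, codeAt_mainProgram.2.1, Instr.exec, s.phys_addr, h]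

theorem quietRun_of_halted_ne_zero (h : s.mem (.main .halted) 0 ≠ 0) :
    QuietRun (mainProgram M F D) O x d (s.config (mainCycle M F D).cost) 1
      (s.config ((mainCycle M F D).cost + 1)) :=
  (QuietRun.jumpZero (c := s.config _) codeAt_mainProgram.2.1).congr le_rfl
    (if_neg (by rwa [← s.phys_addr] at h))

theorem step_emit_of_eq_zero (h : s.mem (.main .emit) 0 = 0) :
    step (mainProgram M F D) O x (s.config ((mainCycle M F D).cost + 1)) =
      s.config ((mainCycle M F D).cost + 4) := by
  simp [step, State.config, State.withReg, codeAt_mainProgram.2.2.1, Instr.exec, s.phys_addr, h]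

theorem quietRun_emit_of_ne_zero (h : s.mem (.main .emit) 0 ≠ 0) :
    QuietRun (mainProgram M F D) O x d (s.config ((mainCycle M F D).cost + 1)) 1
      (s.config ((mainCycle M F D).cost + 2)) :=
  (QuietRun.jumpZero (c := s.config _) codeAt_mainProgram.2.2.1).congr le_rfl
    (if_neg (by rwa [← s.phys_addr] at h))

theorem Tidy.clear_out (h : Tidy O m s) : Tidy O m { s with out := [] } :=
  { h with }

theorem Tidy.raiseFlags (h : Tidy O m s) (hm : 2 ≤ m) : Tidy O m s.raiseFlags :=
  have hone : (1 : ℕ).size ≤ m := by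
    rw [Nat.size_one]
    omega
  (h.set hone).set hone

theorem MainRep.clearFlags_clear_out (h : MainRep O m e s c) (hm : 2 ≤ m) :
    MainRep O m e (State.clearFlags { s.raiseFlags with out := [] }) { c with out := [] } :=
  { h with
    main := { h.main with
      halted := by simp [State.clearFlags]
      emit := by simp [State.clearFlags]
      out := rfl }
    tidy := ((h.tidy.raiseFlags hm).clear_out.set (by simp)).set (by simp) }

theorem two_mul_add_le_digits :
    2 * d + 3 + Program.bound F + Program.bound D ≤ digits M F D d := by
  simp only [digits]
  omega

theorem bound_le_digits : Program.bound M ≤ digits M F D d := by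
  simp only [digits]
  omega

theorem bound_mainProgram_le_digits : Program.bound (mainProgram M F D) ≤ digits M F D d := by
  simp only [digits]
  omega

section

variable (ha : (run (mainProgram M F D) O x a).SizeLe (digits M F D d))

include ha

theorem exists_window_mainProgram
    (hc : QuietRun (mainProgram M F D) O x d (run (mainProgram M F D) O x a)
      (mainCycleTime M F D d) c)
    (hquery : (mainProgram M F D)[c.pc]? ≠ some .query)
    (houtput : ∀ y, ((mainProgram M F D)[c.pc]? = some .output ∧ c.out = y) ↔
      OutputsAt M (decOracle L) x t y)
    (hhalted : HaltedAt M (decOracle L) x t →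
      (mainProgram M F D)[(step (mainProgram M F D) O x c).pc]? = none) :
    ∃ b ≤ a + (mainCycleTime M F D d + 1),
      run (mainProgram M F D) O x b = step (mainProgram M F D) O x c ∧
      Window M (decOracle L) (mainProgram M F D) O x d (digits M F D d + mainCycleTime M F D d)
        t a b :=
  have hd := two_mul_add_le_digits (M := M) (F := F) (D := D) (d := d)
  Window.of_quietRun hc ha ((size_le_self _).trans bound_mainProgram_le_digits) (by omega)
    (by omega) hquery houtput hhalted

variable (hs : QuietRun (mainProgram M F D) O x d (run (mainProgram M F D) O x a) 1 (s.config 0))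

include hs

theorem Sync.next_halted
    (h : MainRep O (digits M F D d) e s.clearFlags (run M (decOracle L) x t))
    (hM : HaltedAt M (decOracle L) x t) :
    ∃ b ≤ a + (mainCycleTime M F D d + 1), Sync O L M F D x d (t + 1) b ∧
      Window M (decOracle L) (mainProgram M F D) O x d (digits M F D d + mainCycleTime M F D d)
        t a b := by
  obtain ⟨-, -, hemit, -, -, hend⟩ := codeAt_mainProgram (M := M) (F := F) (D := D)
  have hm : 2 ≤ digits M F D d := by
    have := two_mul_add_le_digits (M := M) (F := F) (D := D) (d := d)
    omega
  have hstep := exec_mainStep_halted (x := x) (d := d) (F := F) (D := D) h hM hm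
  have hquiet := ((quietRun_mainCycle hs hstep).trans (quietRun_of_halted_ne_zero (by simp))).mono
    (n' := mainCycleTime M F D d) (by
      simp only [mainCycleTime]
      omega)
  have hlast := step_emit_of_eq_zero (M := M) (F := F) (D := D) (O := O) (x := x)
    (s := s.clearFlags.set (.main .halted) 0 1) (by simp [State.clearFlags])
  obtain ⟨b, hb, hrun, hw⟩ := exists_window_mainProgram (t := t) (L := L) ha hquiet
    (by simp [State.config, State.withReg, hemit])
    (fun y => iff_of_false (by simp [State.config, State.withReg, hemit]) hM.not_outputsAt)
    (fun _ => hlast ▸ hend)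
  rw [hlast] at hrun
  refine ⟨b, hb, ⟨?_, .inr ⟨?_, hM.mono (Nat.le_succ t)⟩⟩, hw⟩
  · rw [hrun]
    refine (h.tidy.set ?_).sizeLe_config _
    rw [Nat.size_one]
    omega
  · rw [HaltedAt, hrun]
    exact hend

theorem Sync.next_output
    (h : MainRep O (digits M F D d) e s.clearFlags (run M (decOracle L) x t)) (he : e ≤ 2 * t)
    (hM : M[(run M (decOracle L) x t).pc]? = some .output) :
    ∃ b ≤ a + (mainCycleTime M F D d + 1), Sync O L M F D x d (t + 1) b ∧
      Window M (decOracle L) (mainProgram M F D) O x d (digits M F D d + mainCycleTime M F D d)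
        t a b := by
  obtain ⟨-, -, -, houtput, hjump, -⟩ := codeAt_mainProgram (M := M) (F := F) (D := D)
  have hm : 2 ≤ digits M F D d := by
    have := two_mul_add_le_digits (M := M) (F := F) (D := D) (d := d)
    omega
  obtain ⟨s', hstep, h'⟩ := exec_mainStep_output (x := x) (d := d) (F := F) (D := D) h hM hm
    ((size_le_self _).trans ((succ_pc_le_bound hM).trans bound_le_digits))
  have hhalted : s'.raiseFlags.mem (.main .halted) 0 ≠ 0 := by simp [State.raiseFlags]
  have hemit : s'.raiseFlags.mem (.main .emit) 0 ≠ 0 := by simp [State.raiseFlags]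
  have hquiet := (((quietRun_mainCycle hs hstep).trans (quietRun_of_halted_ne_zero hhalted)).trans
    (quietRun_emit_of_ne_zero hemit)).mono (n' := mainCycleTime M F D d) (by
      simp only [mainCycleTime]
      omega)
  have hlast : step (mainProgram M F D) O x
      (s'.raiseFlags.config ((mainCycle M F D).cost + 2)) =
      State.config { s'.raiseFlags with out := [] } ((mainCycle M F D).cost + 3) := by
    simp only [step, State.config, State.withReg, houtput]
    rfl
  obtain ⟨b, hb, hrun, hw⟩ := exists_window_mainProgram (t := t) (L := L) ha hquiet
    (by simp [State.config, State.withReg, houtput])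
    (fun y => and_congr (iff_of_true houtput hM) (Eq.congr_left h'.main.out))
    (fun hhalted => absurd hM (by rw [hhalted]; simp))
  rw [hlast] at hrun
  refine ⟨b, hb, ⟨?_, .inl ⟨{ s'.raiseFlags with out := [] }, e, by omega, ?_, ?_⟩⟩, hw⟩
  · exact hrun ▸ (h'.tidy.raiseFlags hm).clear_out.sizeLe_config _
  · rw [hrun]
    exact QuietRun.jump hjump
  · rw [run_succ_of_getElem? hM]
    exact h'.clearFlags_clear_out hm

theorem Sync.next_of_exec
    (hstep : Exec O x d (mainStep M F D) s.clearFlags (mainStepTime M F D d) s')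
    (h' : MainRep O (digits M F D d) e s' (run M (decOracle L) x (t + 1))) (he : e ≤ 2 * (t + 1))
    {I : Instr} (hM : M[(run M (decOracle L) x t).pc]? = some I) (hI : I ≠ .output) :
    ∃ b ≤ a + (mainCycleTime M F D d + 1), Sync O L M F D x d (t + 1) b ∧
      Window M (decOracle L) (mainProgram M F D) O x d (digits M F D d + mainCycleTime M F D d)
        t a b := by
  obtain ⟨-, hhalted, -, -, -, -⟩ := codeAt_mainProgram (M := M) (F := F) (D := D)
  have hquiet := (quietRun_mainCycle hs hstep).mono
    (n' := mainCycleTime M F D d) (by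
      simp only [mainCycleTime]
      omega)
  have hlast := step_of_halted_eq_zero (M := M) (F := F) (D := D) (O := O) (x := x) h'.main.halted
  obtain ⟨b, hb, hrun, hw⟩ := exists_window_mainProgram (t := t) (L := L) ha hquiet
    (by simp [State.config, State.withReg, hhalted])
    (fun y => iff_of_false (by simp [State.config, State.withReg, hhalted])
      (by simp [OutputsAt, hM, hI]))
    (fun hhalted => absurd hM (by rw [hhalted]; simp))
  rw [hlast] at hrun
  refine ⟨b, hb, ⟨?_, .inl ⟨s', e, he, ?_, h'.clearFlags⟩⟩, hw⟩
  · exact hrun ▸ h'.tidy.sizeLe_config 0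
  · exact hrun ▸ (QuietRun.refl _).mono zero_le_one

end

theorem Sync.next (h : Sync O L M F D x d t a) (hM : EnumeratesWithin M (decOracle L) x S q)
    (hFD : Answers O L F D q d) (hd : q ≤ d) :
    ∃ b ≤ a + (mainCycleTime M F D d + 1), Sync O L M F D x d (t + 1) b ∧
      Window M (decOracle L) (mainProgram M F D) O x d (digits M F D d + mainCycleTime M F D d)
        t a b := by
  have hm := two_mul_add_le_digits (M := M) (F := F) (D := D) (d := d)
  obtain ⟨ha, ⟨s, e, he, hs, h⟩ | ⟨hP, ht⟩⟩ := h
  · rcases hI : M[(run M (decOracle L) x t).pc]? with _ | I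
    · exact Sync.next_halted ha hs h hI
    have hsize : (2 * t + 2).size ≤ 2 * q + 3 := hM.size_le_of_not_halted (by simp [HaltedAt, hI])
    obtain ⟨-, -, -, hquery, hreg⟩ := hM
    have hsmall := hreg.smallStep (m := digits M F D d) (by omega)
      ((size_le_self _).trans bound_le_digits) hI
    by_cases houtput : I = .output
    · exact Sync.next_output ha hs h he (houtput ▸ hI)
    by_cases hIquery : I = .query
    · subst hIquery
      obtain ⟨i, -, hblank⟩ := exists_qreg_eq_none (M := M) (O := decOracle L) (x := x) (t := t)
      obtain ⟨s', hstep, h'⟩ := exec_mainStep_query (x := x) h hI ⟨i, hblank⟩ hFD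
        (hquery t _ ⟨hI, rfl⟩) hd (size_le_of_le (by omega) (hsize.trans (by omega))) hm
        hsmall.pc_succ
      rw [← run_succ_of_getElem? hI] at h'
      exact Sync.next_of_exec ha hs hstep h' (by omega) hI houtput
    · obtain ⟨s', hstep, h'⟩ := exec_mainStep (x := x) (F := F) (D := D) (d := d) h hI hsmall
        hIquery houtput (by omega)
      rw [← run_succ_of_getElem? hI] at h'
      exact Sync.next_of_exec ha hs hstep h' (by omega) hI houtput
  · exact ⟨a + 1, by omega,
      ⟨by rwa [hP.run_eq a.le_succ], .inr ⟨hP.mono a.le_succ, ht.mono t.le_succ⟩⟩,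
      .of_halted ht hP (ha.mono (by omega))⟩

/-- The memory at the beginning. -/
def startState : State Arr where
  mem _ _ := 0
  qreg _ := none
  ans := 0
  asked _ := 0
  out := []

theorem startState_config : startState.config 0 = startConfig := by
  simp only [State.config, State.withReg, startState, startConfig, Config.mk.injEq, and_true,
    true_and]
  funext i
  exact congrFun (Function.extend_const _ 0) i

theorem mainRep_startState : MainRep O m 0 startState startConfig where
  main := by constructor <;> rfl
  tidy := by constructor <;> simp [startState]
  epoch := rfl

theorem sync_zero : Sync O L M F D x d 0 0 :=
  ⟨⟨fun _ => by simp [run, startConfig], by simp [run, startConfig]⟩,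
    .inl ⟨startState, 0, le_rfl,
      (QuietRun.refl startConfig).congr zero_le_one startState_config.symm,
      mainRep_startState.clearFlags⟩⟩

theorem exists_schedule_mainProgram (hM : EnumeratesWithin M (decOracle L) x S q)
    (hFD : Answers O L F D q d) (hd : q ≤ d) :
    ∃ τ, Schedule M (decOracle L) (mainProgram M F D) O x d
      (digits M F D d + mainCycleTime M F D d) (mainCycleTime M F D d + 1) τ := by
  choose next hle hsync hwindow using
    fun t a (h : Sync O L M F D x d t a) => h.next hM hFD hd
  let τ : ∀ t, {a // Sync O L M F D x d t a} :=
    Nat.rec ⟨0, sync_zero⟩ fun t a => ⟨next t a a.2, hsync t a a.2⟩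
  exact ⟨fun t => (τ t).1, rfl, fun t => hle t _ (τ t).2, fun t => hwindow t _ (τ t).2⟩

theorem enumeratesWithin_mainProgram (hM : EnumeratesWithin M (decOracle L) x S q)
    (hFD : Answers O L F D q d) (hd : q ≤ d) :
    EnumeratesWithin (mainProgram M F D) O x S (delay M F D d) := by
  obtain ⟨τ, hτ⟩ := exists_schedule_mainProgram hM hFD hd
  have hdigits := two_mul_add_le_digits (M := M) (F := F) (D := D) (d := d)
  have htime : (q + 1) * (mainCycleTime M F D d + 1) ≤ (d + 1) * (mainCycleTime M F D d + 1) :=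
    Nat.mul_le_mul_right _ (by omega)
  have hcycle : mainCycleTime M F D d + 1 ≤ (d + 1) * (mainCycleTime M F D d + 1) :=
    Nat.le_mul_of_pos_left _ d.succ_pos
  exact hτ.enumeratesWithin hM (by unfold delay; omega) (by unfold delay; omega)
    (by unfold delay; omega)

end

/-! ### Polynomial bounds -/

theorem eval_mono_of_nat (p : Polynomial ℕ) : Monotone fun n => p.eval n := by
  intro a b h
  simp only [Polynomial.eval_eq_sum_range]
  gcongr

section
variable {M : Program} {O : Oracle} {x y : Word} {p : Prop} {d d' : ℕ}

theorem RegistersBounded.mono (h : RegistersBounded M O x d) (hd : d ≤ d') :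
    RegistersBounded M O x d' :=
  fun t => ⟨fun i => ((h t).1 i).trans hd, (h t).2.trans hd⟩

theorem ComputesWithin.mono (h : ComputesWithin M O x y d) (hd : d ≤ d') :
    ComputesWithin M O x y d' :=
  ⟨h.1.mono hd, by rw [h.1.run_eq hd]; exact h.2.1, h.2.2.mono hd⟩

theorem DecidesWithin.mono (h : DecidesWithin M O x p d) (hd : d ≤ d') :
    DecidesWithin M O x p d' :=
  ⟨h.1.mono hd, by rw [h.1.run_eq hd]; exact h.2.1, h.2.2.mono hd⟩

theorem ComputesWithin.length_le (h : ComputesWithin M O x y d) : y.length ≤ d :=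
  h.2.1 ▸ length_out_le

end

theorem Answers.of_reduction {O : Oracle} {L A : DecProblem} {F D : Program} {f : Word → Word}
    {pF pD : Polynomial ℕ} {q d : ℕ}
    (hF : ∀ w, ComputesWithin F noOracle w (f w) (pF.eval w.length)) (hf : ∀ w, w ∈ L ↔ f w ∈ A)
    (hD : ∀ y, DecidesWithin D O y (y ∈ A) (pD.eval y.length)) (hpF : pF.eval q ≤ d)
    (hpD : pD.eval (pF.eval q) ≤ d) : Answers O L F D q d := by
  intro w hw
  have hlength : pF.eval w.length ≤ pF.eval q := eval_mono_of_nat pF hw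
  have htime : pD.eval (f w).length ≤ pD.eval (pF.eval q) :=
    eval_mono_of_nat pD ((hF w).length_le.trans hlength)
  refine ⟨f w, (hF w).mono (hlength.trans hpF), ?_⟩
  rw [hf w]
  exact (hD (f w)).mono (htime.trans hpD)

open Polynomial in
theorem Stage.exists_eval_eq_callTime (st : Stage) (P : Program) :
    ∃ p : ℕ[X], ∀ d, p.eval d = st.callTime P d :=
  ⟨((st.call P).cost : ℕ[X]) +
      (X + 1) * (2 * ((st.loop P).cost : ℕ[X]) + (X + 1) * (st.iface.query.cost : ℕ[X])),
    fun d => by simp [Stage.callTime, Stage.stepTime]⟩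

open Polynomial in
theorem exists_eval_eq_delay (M F D : Program) : ∃ p : ℕ[X], ∀ d, p.eval d = delay M F D d := by
  obtain ⟨pF, hF⟩ := Stage.reduction.exists_eval_eq_callTime F
  obtain ⟨pD, hD⟩ := Stage.decision.exists_eval_eq_callTime D
  refine ⟨2 * X + 3 + (Program.bound M : ℕ[X]) + (Program.bound F : ℕ[X]) +
      (Program.bound D : ℕ[X]) + (Program.bound (mainProgram M F D) : ℕ[X]) +
      (X + 1) * (((mainCycle M F D).cost : ℕ[X]) + (2 * ((mainStep M F D).cost : ℕ[X]) +
        (((answerQuery F D).cost : ℕ[X]) + (X + 1) * (queryLengthLoop.cost : ℕ[X]) + pF + pD)) +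
          3 + 1),
    fun d => ?_⟩
  simp only [eval_add, eval_mul, eval_X, eval_natCast, eval_ofNat, eval_one, hF, hD, delay, digits,
    mainCycleTime, mainStepTime, answerQueryTime, Nat.cast_id]

theorem DReducible.of_polyManyOneReducible {L A : DecProblem} {B E : EnumProblem}
    (hB : B ∈ Del {L}) (hL : PolyManyOneReducible L A) (hA : DecidableInPolyTimeWith A E) :
    DReducible B E := by
  obtain ⟨_, rfl, M, pM, hM⟩ := hB
  obtain ⟨f, ⟨F, pF, hF⟩, hf⟩ := hL
  obtain ⟨D, pD, hD⟩ := hA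
  obtain ⟨p, hp⟩ := exists_eval_eq_delay M F D
  refine ⟨mainProgram M F D, p.comp (pM + pF.comp pM + pD.comp (pF.comp pM)), fun a ha x => ?_⟩
  simp only [Polynomial.eval_comp, Polynomial.eval_add, hp]
  refine enumeratesWithin_mainProgram (hM x) (.of_reduction hF hf (hD a ha) ?_ ?_) ?_ <;> omega

end EnumComplexity

theorem mainTheorem11_general {C : Set EnumComplexity.DecProblem} {A : EnumComplexity.DecProblem}
    {E : EnumComplexity.EnumProblem} (hA : EnumComplexity.IsHard C A)
    (hE : EnumComplexity.DecidableInPolyTimeWith A E) :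
    EnumComplexity.IsDHard (EnumComplexity.Del C) E := by
  rintro B ⟨L, hL, hB⟩
  exact .of_polyManyOneReducible ⟨L, rfl, hB⟩ (hA L hL) hE

theorem mainTheorem11 (k : ℕ) (A : EnumComplexity.DecProblem) (E : EnumComplexity.EnumProblem)
    (hA : EnumComplexity.IsHard (EnumComplexity.SigmaP k) A)
    (hE : EnumComplexity.DecidableInPolyTimeWith A E) :
    EnumComplexity.IsDHard (EnumComplexity.Del (EnumComplexity.SigmaP k)) E :=
  mainTheorem11_general hA hE
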